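/- **Theorem.** For a field $K$, let $K[X]\langle\partial\rangle=K\langle X,\partial;\ \partial X=X\partial+1\rangle$ and $K[X]\langle\theta\rangle=K\langle X,\theta;\ \theta X=X(\theta+1)\rangle$. For $D\in\{\partial,\theta\}$, an operator of bidegree at most $(d,r)$ in $K[X]\langle D\rangle$ is given by its canonical form, that is, by the coefficients $a_{i,j}\in K$ of $\sum_{0\le i\le d,\,0\le j\le r}a_{i,j}X^iD^j$. To multiply two operators of bidegree at most $(n,n)$ means to compute the coefficients of the canonical form of their product (of bidegree at most $(2n,2n)$) from those of the factors. Complexity is the number of arithmetic operations $+,-,\times,\div$ in $K$ (straight-line programs over $K$ with constants from $K$). (i) Let $K$ be a field of characteristic $p>0$, and let $\mathsf M:\mathbb N\to\mathbb N$ be such that, for all $n$, polynomials of degree at most $n$ in $K[X]$ can be multiplied in $\mathsf M(n)$ operations. Suppose that $\mathsf M(m)/m\le \mathsf M(n)/n$ for $1\le m\le n$, and that $\mathsf M(cn)\le\kappa(c)\,\mathsf M(n)$ for all integers $c,n\ge1$, with constants $\kappa(c)$. Then, for each $D\in\{\partial,\theta\}$ and every $n\ge 1$, two operators of bidegree at most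 $(n,n)$ in $K[X]\langle D\rangle$ can be multiplied in at most $$C\,\bigl(p\,\mathsf M(n^2)+p\,n\,\mathsf M(n)\log n\bigr)$$ operations, where the constant $C$ depends only on the function $\kappa$ (not on $p$, $K$, $\mathsf M$ or $n$). (ii) Consequently, with FFT-based polynomial multiplication, the product can be computed in $\tilde{\mathcal O}(pn^2)$ operations: there are absolute constants $C>0$ and $m\in\mathbb N$ such that, for every prime $p$, every field $K$ of characteristic $p$, each $D\in\{\partial,\theta\}$ and every $n\ge1$, two operators of bidegree at most $(n,n)$ in $K[X]\langle D\rangle$ can be multiplied in at most $C\,p\,n^2\,\log^m(p\,n^2)$ operations. -/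

import Mathlib

universe u

/-! ## Arithmetic complexity: straight-line programs over a field -/

/-- An operand of an arithmetic instruction: a constant of `K`, an input variable, or the result of
the `k`-th earlier instruction (counted from `0`). Reading an operand costs nothing. -/
inductive Operand (K ι : Type*) where
  | const (c : K)
  | input (i : ι)
  | reg (k : ℕ)

/-- The four arithmetic operations of a field. -/
inductive ArithOp where
  | add
  | sub
  | mul
  | div

/-- One arithmetic instruction: apply `op` to two operands. -/
structure Instr (K ι : Type*) where
  op : ArithOp
  lhs : Operand K ι
  rhs : Operand K ι

/-- The value of an operand on input `x`, given the list of results of the earlier instructions;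
undefined if it refers to a result that does not exist. -/
def Operand.eval {K ι : Type*} (x : ι → K) (regs : List K) : Operand K ι → Option K
  | .const c => some c
  | .input i => some (x i)
  | .reg k => regs[k]?

open Classical in
/-- The result of an arithmetic operation; division by zero is undefined. -/
noncomputable def ArithOp.eval {K : Type*} [Field K] : ArithOp → K → K → Option K
  | .add, a, b => some (a + b)
  | .sub, a, b => some (a - b)
  | .mul, a, b => some (a * b)
  | .div, a, b => if b = 0 then none else some (a / b)

/-- Run a straight-line program on input `x`, starting with the results `regs`; each instruction
appends its result. The run is undefined as soon as one of the instructions is. -/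
noncomputable def runProgram {K ι : Type*} [Field K] (x : ι → K) :
    List (Instr K ι) → List K → Option (List K)
  | [], regs => some regs
  | I :: P, regs =>
      (I.lhs.eval x regs).bind fun a =>
        (I.rhs.eval x regs).bind fun b =>
          (I.op.eval a b).bind fun c =>
            runProgram x P (regs ++ [c])

/-- `SLPComputable F N`: some straight-line program of at most `N` arithmetic operations in `K`
computes `F x` for every input `x`. The outputs are read off from constants, inputs and results. -/
def SLPComputable {K ι o : Type*} [Field K] (F : (ι → K) → o → K) (N : ℕ) : Prop :=
  ∃ (P : List (Instr K ι)) (out : o → Operand K ι),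
    P.length ≤ N ∧
    ∀ x : ι → K, ∃ regs : List K,
      runProgram x P [] = some regs ∧ ∀ k : o, (out k).eval x regs = some (F x k)

/-! ## Multiplication of commutative polynomials -/

/-- The polynomial with coefficients `a 0, …, a n`. -/
noncomputable def polyOfCoeffs {K : Type*} [Field K] {n : ℕ} (a : Fin (n + 1) → K) :
    Polynomial K :=
  ∑ i : Fin (n + 1), Polynomial.monomial (i : ℕ) (a i)

/-- The problem of multiplying two polynomials of degree at most `n`: coefficients of the factors
as input, coefficients of the product as output. -/
noncomputable def polyMulMap (K : Type*) [Field K] (n : ℕ)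
    (x : Fin (n + 1) ⊕ Fin (n + 1) → K) : Fin (2 * n + 1) → K :=
  fun k => (polyOfCoeffs (fun i => x (Sum.inl i)) * polyOfCoeffs (fun i => x (Sum.inr i))).coeff k

/-- Polynomials of degree at most `n` over `K` can be multiplied in `M n` operations, for all `n`. -/
def IsPolyMulTime (K : Type*) [Field K] (M : ℕ → ℕ) : Prop :=
  ∀ n : ℕ, SLPComputable (polyMulMap K n) (M n)

/-- Super-linearity: `M m / m ≤ M n / n` for `1 ≤ m ≤ n`. -/
def IsSuperlinear (M : ℕ → ℕ) : Prop :=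
  ∀ m n : ℕ, 1 ≤ m → m ≤ n → n * M m ≤ m * M n

/-- `M (c n) = O(M n)` for every positive integer `c`, with implied constants `κ c`. -/
def HasScaling (κ : ℕ → ℝ) (M : ℕ → ℕ) : Prop :=
  ∀ c n : ℕ, 1 ≤ c → 1 ≤ n → (M (c * n) : ℝ) ≤ κ c * M n

/-! ## The algebras of linear differential operators -/

/-- The names of the two generators. -/
inductive OpGen where
  | X
  | D

/-- The defining relation `∂ X = X ∂ + 1`. -/
inductive PartialRel (K : Type u) [Field K] : FreeAlgebra K OpGen → FreeAlgebra K OpGen → Prop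
  | comm : PartialRel K (FreeAlgebra.ι K OpGen.D * FreeAlgebra.ι K OpGen.X)
      (FreeAlgebra.ι K OpGen.X * FreeAlgebra.ι K OpGen.D + 1)

/-- The defining relation `θ X = X (θ + 1)`. -/
inductive ThetaRel (K : Type u) [Field K] : FreeAlgebra K OpGen → FreeAlgebra K OpGen → Prop
  | comm : ThetaRel K (FreeAlgebra.ι K OpGen.D * FreeAlgebra.ι K OpGen.X)
      (FreeAlgebra.ι K OpGen.X * (FreeAlgebra.ι K OpGen.D + 1))

/-- `K[X]⟨∂⟩`, the associative `K`-algebra generated by `X, ∂` subject to `∂ X = X ∂ + 1`. -/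
abbrev PartialAlg (K : Type u) [Field K] : Type u := RingQuot (PartialRel K)

/-- `K[X]⟨θ⟩`, the associative `K`-algebra generated by `X, θ` subject to `θ X = X (θ + 1)`. -/
abbrev ThetaAlg (K : Type u) [Field K] : Type u := RingQuot (ThetaRel K)

/-- The images of the generators in `K[X]⟨∂⟩`. -/
noncomputable def PartialAlg.gen (K : Type u) [Field K] (g : OpGen) : PartialAlg K :=
  RingQuot.mkAlgHom K (PartialRel K) (FreeAlgebra.ι K g)

/-- The images of the generators in `K[X]⟨θ⟩`. -/
noncomputable def ThetaAlg.gen (K : Type u) [Field K] (g : OpGen) : ThetaAlg K :=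
  RingQuot.mkAlgHom K (ThetaRel K) (FreeAlgebra.ι K g)

/-- The operator with canonical form `∑ a (i, j) X ^ i D ^ j`, of bidegree at most `(d, r)`. -/
noncomputable def ofCanonical {K A : Type*} [Field K] [Ring A] [Algebra K A] (X D : A) {d r : ℕ}
    (a : Fin (d + 1) × Fin (r + 1) → K) : A :=
  ∑ i : Fin (d + 1), ∑ j : Fin (r + 1), a (i, j) • (X ^ (i : ℕ) * D ^ (j : ℕ))

/-- Two operators of bidegree at most `(n, n)` in `X` and `D`, given in canonical form, can be
multiplied in `N` arithmetic operations, the product being returned in canonical form. -/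
def OpMulIn (K : Type*) {A : Type*} [Field K] [Ring A] [Algebra K A] (X D : A) (n N : ℕ) : Prop :=
  ∃ F : ((Fin (n + 1) × Fin (n + 1)) ⊕ (Fin (n + 1) × Fin (n + 1)) → K) →
      (Fin (2 * n + 1) × Fin (2 * n + 1) → K),
    SLPComputable F N ∧
    ∀ x, ofCanonical X D (F x) =
      ofCanonical X D (fun ij => x (Sum.inl ij)) * ofCanonical X D (fun ij => x (Sum.inr ij))

/-- Two operators of bidegree at most `(n, n)` in `K[X]⟨∂⟩` can be multiplied in `N` operations. -/
def PartialMulIn (K : Type u) [Field K] (n N : ℕ) : Prop :=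
  OpMulIn K (PartialAlg.gen K OpGen.X) (PartialAlg.gen K OpGen.D) n N

/-- Two operators of bidegree at most `(n, n)` in `K[X]⟨θ⟩` can be multiplied in `N` operations. -/
def ThetaMulIn (K : Type u) [Field K] (n N : ℕ) : Prop :=
  OpMulIn K (ThetaAlg.gen K OpGen.X) (ThetaAlg.gen K OpGen.D) n N

/-! In characteristic `p`, multiplication of operators reduces to `p` commutative multiplications of
bivariate polynomials. For `∂`, the commutation rule `D ^ j * X ^ k = ∑ s! (j choose s) (k choose s)
X ^ (k - s) D ^ (j - s)` stops at `s < p`, because `s!` vanishes in `K` from `s = p` on. For fixed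
`s` the factors `j choose s` and `k choose s` can be absorbed into the left and right operator
respectively, so the `s`-th term is a commutative product (`weyl_product`). For `θ`, `P(θ) X ^ k = X
^ k P(θ + k)` depends on `k` in the shift only modulo `p`. Splitting the right factor by the residue
`s` of its `X`-exponent leaves one commutative product for each `s`, with the left factor shifted by
`s` (`theta_product`).

Kronecker substitution turns each bivariate product into a univariate one of degree `O(n ^ 2)`
(`OpMulIn.of_commutative_products`), whence `p M(n ^ 2)`. The `p (n + 1)` Taylor shifts needed for
`θ` are done by divide and conquer (`SLC.taylorShift`), whence `p n M(n) log n`.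

Part (ii) needs one quasi-linear `M` valid over every field of positive characteristic, whatever
roots of unity it contains. A Schönhage–Strassen recursion supplies it: cut the polynomials into
blocks, and use the class of `y` in `S[y] / (y ^ N - 1)`, `N = l ^ (q + 1)`, as a root of unity, so
that multiplication by its powers only permutes coefficients. The prime `l`, equal to 2 or 3, is
chosen different from `p`, so that `N` can be inverted. Orthogonality of the transform fails modulo
`y ^ N - 1` but holds after multiplication by `1 - y ^ (N / l)`; this is harmless for coefficients
of degree less than `N / l` (`coeff_eq_of_cyclicDFT`).

Costs are counted by `SLC` inside a commutative algebra `S`. For `S` the algebra of functions of the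
inputs, this notion is equivalent to straight-line programs, and it composes without register
bookkeeping. -/

open Polynomial

/-! ### Calculus of arithmetic costs in a commutative algebra -/

/-- The elements of `A` together with the constants from `K`. -/
def withConsts (K : Type*) {S : Type*} [Field K] [CommRing S] [Algebra K S] (A : Set S) : Set S :=
  A ∪ Set.range (algebraMap K S)

/-- `c` is the result of one arithmetic operation on elements of `A` and constants. -/
def IsArithStep (K : Type*) {S : Type*} [Field K] [CommRing S] [Algebra K S]
    (A : Set S) (c : S) : Prop :=
  ∃ a ∈ withConsts K A, ∃ b ∈ withConsts K A,
    c = a + b ∨ c = a - b ∨ c = a * b ∨ (IsUnit b ∧ c * b = a)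

/-- From the elements of `A` and the constants of `K`, at most `N` arithmetic operations yield all
the elements of `B`. -/
inductive SLC (K : Type*) {S : Type*} [Field K] [CommRing S] [Algebra K S] :
    Set S → ℕ → Set S → Prop
  | done {A B : Set S} {N : ℕ} (h : B ⊆ withConsts K A) : SLC K A N B
  | step {A B : Set S} {N : ℕ} {c : S} (h : IsArithStep K A c) (t : SLC K (insert c A) N B) :
      SLC K A (N + 1) B

section Basic

variable {K S : Type*} [Field K] [CommRing S] [Algebra K S]

theorem subset_withConsts (A : Set S) : A ⊆ withConsts K A := Set.subset_union_left

theorem algebraMap_mem_withConsts (A : Set S) (c : K) : algebraMap K S c ∈ withConsts K A :=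
  Or.inr ⟨c, rfl⟩

theorem zero_mem_withConsts (A : Set S) : (0 : S) ∈ withConsts K A := Or.inr ⟨0, map_zero _⟩

theorem withConsts_subset {A A' : Set S} (h : A ⊆ withConsts K A') :
    withConsts K A ⊆ withConsts K A' :=
  Set.union_subset h Set.subset_union_right

theorem withConsts_mono {A A' : Set S} (h : A ⊆ A') : withConsts K A ⊆ withConsts K A' :=
  Set.union_subset_union_left _ h

theorem IsArithStep.mono {A A' : Set S} {c : S} (h : A ⊆ withConsts K A')
    (hc : IsArithStep K A c) : IsArithStep K A' c := by
  obtain ⟨a, ha, b, hb, e⟩ := hc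
  exact ⟨a, withConsts_subset h ha, b, withConsts_subset h hb, e⟩

theorem SLC.mono_left {A A' B : Set S} {N : ℕ} (t : SLC K A N B) (h : A ⊆ withConsts K A') :
    SLC K A' N B := by
  induction t generalizing A' with
  | done hB => exact .done (hB.trans (withConsts_subset h))
  | step hc _ ih =>
    refine .step (hc.mono h) (ih ?_)
    rintro x (rfl | hx)
    · exact subset_withConsts _ (Set.mem_insert _ _)
    · exact withConsts_mono (Set.subset_insert _ _) (h hx)

theorem SLC.mono_right {A B B' : Set S} {N : ℕ} (t : SLC K A N B) (h : B' ⊆ withConsts K B) :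
    SLC K A N B' := by
  induction t with
  | done hB => exact .done (h.trans (withConsts_subset hB))
  | step hc _ ih => exact .step hc (ih h)

theorem SLC.mono_right' {A B B' : Set S} {N : ℕ} (t : SLC K A N B) (h : B' ⊆ B) :
    SLC K A N B' :=
  t.mono_right (h.trans (subset_withConsts _))

theorem SLC.mono_cost {A B : Set S} {N N' : ℕ} (t : SLC K A N B) (h : N ≤ N') :
    SLC K A N' B := by
  induction t generalizing N' with
  | done hB => exact .done hB
  | step hc _ ih =>
    obtain ⟨k, rfl⟩ := Nat.exists_eq_add_of_le h
    rw [add_right_comm]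
    exact .step hc (ih (Nat.le_add_right _ _))

/-- Appending the second computation to the first: intermediate results are never discarded, so `B`
stays available and may be reused by later tasks. -/
theorem SLC.trans_union {A B B' : Set S} {N N' : ℕ} (t : SLC K A N B)
    (t' : SLC K (A ∪ B) N' B') : SLC K A (N + N') (B ∪ B') := by
  induction t with
  | @done A B N hB =>
    refine SLC.mono_cost (N := N') ?_ (Nat.le_add_left _ _)
    have h1 : SLC K A N' B' :=
      t'.mono_left (Set.union_subset (subset_withConsts _) hB)
    clear t'
    induction h1 with
    | done h => exact .done (Set.union_subset hB h)
    | step hc _ ih =>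
      exact .step hc (ih (hB.trans (withConsts_mono (Set.subset_insert _ _))))
  | @step A B N c hc _ ih =>
    rw [add_right_comm]
    refine .step hc (ih (t'.mono_left ?_))
    refine (Set.union_subset_union_left _ (Set.subset_insert _ _)).trans (subset_withConsts _)

/-- Composition: compute `B`, then `B'` from `A` and `B`. -/
theorem SLC.trans {A B B' : Set S} {N N' : ℕ} (t : SLC K A N B)
    (t' : SLC K (A ∪ B) N' B') : SLC K A (N + N') B' :=
  (t.trans_union t').mono_right' Set.subset_union_right

/-- Composition: compute `B`, then `B'` from `B` alone. -/
theorem SLC.trans' {A B B' : Set S} {N N' : ℕ} (t : SLC K A N B)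
    (t' : SLC K B N' B') : SLC K A (N + N') B' :=
  t.trans (t'.mono_left (Set.subset_union_right.trans (subset_withConsts _)))

theorem SLC.union {A B B' : Set S} {N N' : ℕ} (t : SLC K A N B) (t' : SLC K A N' B') :
    SLC K A (N + N') (B ∪ B') :=
  t.trans_union (t'.mono_left (Set.subset_union_left.trans (subset_withConsts _)))

theorem SLC.biUnion {ι : Type*} {A : Set S} (s : Finset ι) {N : ι → ℕ} {B : ι → Set S}
    (h : ∀ i ∈ s, SLC K A (N i) (B i)) : SLC K A (∑ i ∈ s, N i) (⋃ i ∈ s, B i) := by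
  classical
  induction s using Finset.induction_on with
  | empty => exact .done (by simp)
  | insert i s hi ih =>
    rw [Finset.sum_insert hi, Finset.set_biUnion_insert]
    exact (h i (Finset.mem_insert_self _ _)).union
      (ih fun j hj => h j (Finset.mem_insert_of_mem hj))

/-- A finite family of tasks of equal cost. -/
theorem SLC.family {ι : Type*} {A : Set S} (s : Finset ι) {N : ℕ} {B : ι → Set S}
    (h : ∀ i ∈ s, SLC K A N (B i)) : SLC K A (s.card * N) (⋃ i ∈ s, B i) := by
  simpa using SLC.biUnion s h

theorem SLC.of_step {A : Set S} {c : S} (h : IsArithStep K A c) : SLC K A 1 {c} :=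
  .step h (.done (by
    rintro x rfl
    exact subset_withConsts _ (Set.mem_insert _ _)))

theorem SLC.add {A : Set S} {a b : S} (ha : a ∈ withConsts K A) (hb : b ∈ withConsts K A) :
    SLC K A 1 {a + b} := .of_step ⟨a, ha, b, hb, Or.inl rfl⟩

theorem SLC.sub {A : Set S} {a b : S} (ha : a ∈ withConsts K A) (hb : b ∈ withConsts K A) :
    SLC K A 1 {a - b} := .of_step ⟨a, ha, b, hb, Or.inr (Or.inl rfl)⟩

theorem SLC.mul {A : Set S} {a b : S} (ha : a ∈ withConsts K A) (hb : b ∈ withConsts K A) :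
    SLC K A 1 {a * b} := .of_step ⟨a, ha, b, hb, Or.inr (Or.inr (Or.inl rfl))⟩

theorem SLC.singleton_of_mem {A : Set S} {a : S} (ha : a ∈ withConsts K A) : SLC K A 0 {a} :=
  .done (Set.singleton_subset_iff.2 ha)

/-- A sum of available elements costs at most one addition per summand. -/
theorem SLC.sum {ι : Type*} {A : Set S} (s : Finset ι) {f : ι → S}
    (h : ∀ i ∈ s, f i ∈ withConsts K A) : SLC K A s.card {∑ i ∈ s, f i} := by
  classical
  induction s using Finset.induction_on with
  | empty => exact .singleton_of_mem (by simpa using zero_mem_withConsts A)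
  | insert i s hi ih =>
    rw [Finset.sum_insert hi, Finset.card_insert_of_notMem hi]
    refine (ih fun j hj => h j (Finset.mem_insert_of_mem hj)).trans (.add ?_ ?_)
    · exact withConsts_mono Set.subset_union_left (h i (Finset.mem_insert_self _ _))
    · exact subset_withConsts _ (Or.inr rfl)

/-- Grouped sums: the sums over the fibres of `g` cost at most one addition per summand. -/
theorem SLC.fiber_sums {ι κ : Type*} [DecidableEq κ] {A : Set S} (s : Finset ι) (g : ι → κ)
    {f : ι → S} (h : ∀ i ∈ s, f i ∈ withConsts K A) :
    SLC K A s.card (Set.range fun k => ∑ i ∈ s with g i = k, f i) := by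
  have key := SLC.biUnion (K := K) (A := A) (s.image g) (N := fun k => (s.filter (g · = k)).card)
    (B := fun k => {∑ i ∈ s with g i = k, f i})
    (fun k _ => SLC.sum _ fun i hi => h i (Finset.mem_filter.1 hi).1)
  rw [← Finset.card_eq_sum_card_image] at key
  refine key.mono_right ?_
  rintro _ ⟨k, rfl⟩
  -- Empty fibres need no operation: their sum is the constant 0.
  by_cases hk : k ∈ s.image g
  · exact subset_withConsts _ (Set.mem_biUnion hk rfl)
  · have : s.filter (g · = k) = ∅ := by
      rw [Finset.filter_eq_empty_iff]
      exact fun i hi e => hk (Finset.mem_image.2 ⟨i, hi, e⟩)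
    simpa only [this, Finset.sum_empty] using zero_mem_withConsts _

end Basic

/-! ### Equivalence with straight-line programs -/

section Programs

/-- The value of an operand on inputs `g` in an algebra of functions. -/
theorem Operand.eval_mem {K ι X : Type*} [Field K] [Nonempty X] {A : Set (X → K)}
    {g : ι → X → K} (hg : ∀ i, g i ∈ withConsts K A) {R : List (X → K)}
    (hR : ∀ r ∈ R, r ∈ withConsts K A) (o : Operand K ι) {f : X → K}
    (h : ∀ x, o.eval (fun i => g i x) (R.map (· x)) = some (f x)) : f ∈ withConsts K A := by
  cases o with
  | const c =>
    refine Or.inr ⟨c, ?_⟩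
    funext x
    simpa [Operand.eval] using h x
  | input i =>
    have : f = g i := by
      funext x
      simpa [Operand.eval] using (h x).symm
    exact this ▸ hg i
  | reg k =>
    -- One input point is enough to show that the register exists, since the length of `R` does not
    -- depend on `x`.
    obtain ⟨x₀⟩ := ‹Nonempty X›
    have hk : k < R.length := by
      by_contra hk
      have := h x₀
      simp [Operand.eval, List.getElem?_eq_none (not_lt.1 hk)] at this
    have : f = R[k] := by
      funext x
      simpa [Operand.eval, hk] using (h x).symm
    exact this ▸ hR _ (List.getElem_mem hk)

/-- Running a program on available inputs. -/
theorem SLC.of_runProgram {K ι o X : Type*} [Field K] [Nonempty X] {g : ι → X → K}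
    {out : o → Operand K ι} {f : o → X → K} (P : List (Instr K ι)) {A : Set (X → K)}
    (hg : ∀ i, g i ∈ withConsts K A) {R : List (X → K)} (hR : ∀ r ∈ R, r ∈ withConsts K A)
    (h : ∀ x, ∃ regs, runProgram (fun i => g i x) P (R.map (· x)) = some regs ∧
      ∀ k, (out k).eval (fun i => g i x) regs = some (f k x)) :
    SLC K A P.length (Set.range f) := by
  induction P generalizing A R with
  | nil =>
    refine .done ?_
    rintro _ ⟨k, rfl⟩
    refine Operand.eval_mem hg hR (out k) fun x => ?_
    obtain ⟨regs, h1, h2⟩ := h x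
    simp only [runProgram, Option.some.injEq] at h1
    exact h1 ▸ h2 k
  | cons I P ih =>
    have h' : ∀ x, ∃ a, ∃ b, ∃ c, I.lhs.eval (fun i => g i x) (R.map (· x)) = some a ∧
        I.rhs.eval (fun i => g i x) (R.map (· x)) = some b ∧ I.op.eval a b = some c ∧
        ∃ regs, runProgram (fun i => g i x) P (R.map (· x) ++ [c]) = some regs ∧
          ∀ k, (out k).eval (fun i => g i x) regs = some (f k x) := by
      intro x
      obtain ⟨regs, h1, h2⟩ := h x
      simp only [runProgram, Option.bind_eq_some_iff] at h1
      obtain ⟨a, ha, b, hb, c, hc, h3⟩ := h1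
      exact ⟨a, b, c, ha, hb, hc, regs, h3, h2⟩
    choose a b c ha hb hc h2 using h'
    have hstep : IsArithStep K A c := by
      refine ⟨a, Operand.eval_mem hg hR I.lhs ha, b, Operand.eval_mem hg hR I.rhs hb, ?_⟩
      cases hop : I.op <;> simp only [hop, ArithOp.eval] at hc
      · exact Or.inl (funext fun x => by simpa using (hc x).symm)
      · exact Or.inr (Or.inl (funext fun x => by simpa using (hc x).symm))
      · exact Or.inr (Or.inr (Or.inl (funext fun x => by simpa using (hc x).symm)))
      -- The program is defined on every input, so the denominator vanishes nowhere; it is therefore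
      -- a unit of the algebra of functions.
      · refine Or.inr (Or.inr (Or.inr ?_))
        have hb0 : ∀ x, b x ≠ 0 := fun x hx => by simpa [hx] using hc x
        refine ⟨Pi.isUnit_iff.2 fun x => (hb0 x).isUnit, funext fun x => ?_⟩
        have := hc x
        rw [if_neg (hb0 x), Option.some.injEq] at this
        rw [Pi.mul_apply, ← this, div_mul_cancel₀ _ (hb0 x)]
    refine .step hstep (ih (R := R ++ [c]) (fun i => ?_) (fun r hr => ?_) fun x => ?_)
    · exact withConsts_mono (Set.subset_insert _ _) (hg i)
    · rcases List.mem_append.1 hr with hr | hr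
      · exact withConsts_mono (Set.subset_insert _ _) (hR r hr)
      · rw [List.mem_singleton.1 hr]
        exact subset_withConsts _ (Set.mem_insert _ _)
    · simpa using h2 x

/-- Substituting available functions into a computable map. -/
theorem SLPComputable.slc {K ι o X : Type*} [Field K] [Nonempty X] {F : (ι → K) → o → K} {N : ℕ}
    (hF : SLPComputable F N) {A : Set (X → K)} {g : ι → X → K}
    (hg : ∀ i, g i ∈ withConsts K A) :
    SLC K A N (Set.range fun (k : o) (x : X) => F (fun i => g i x) k) := by
  obtain ⟨P, out, hP, h⟩ := hF
  refine (SLC.of_runProgram (out := out) P hg (R := []) (by simp) fun x => ?_).mono_cost hP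
  exact h _

theorem Operand.eval_append {K ι : Type*} {x : ι → K} {R R' : List K} {o : Operand K ι} {a : K}
    (h : o.eval x R = some a) : o.eval x (R ++ R') = some a := by
  cases o with
  | const c => exact h
  | input i => exact h
  | reg k =>
    simp only [Operand.eval] at h ⊢
    have hk : k < R.length := by
      by_contra hk
      simp [List.getElem?_eq_none (not_lt.1 hk)] at h
    rw [List.getElem?_append_left hk, h]

/-- The length `L` of the register list is the same for all inputs, so the next result sits in
register `L` uniformly in `x`; this makes the compiled program independent of the input. -/
theorem SLC.exists_program {K ι : Type*} [Field K] {A B : Set ((ι → K) → K)} {N : ℕ}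
    (t : SLC K A N B) (R : (ι → K) → List K) (L : ℕ) (hL : ∀ x, (R x).length = L)
    (hA : ∀ a ∈ A, ∃ o : Operand K ι, ∀ x, o.eval x (R x) = some (a x)) :
    ∃ P : List (Instr K ι), P.length ≤ N ∧ ∃ R' : (ι → K) → List K,
      (∀ x, runProgram x P (R x) = some (R' x)) ∧
      ∀ b ∈ B, ∃ o : Operand K ι, ∀ x, o.eval x (R' x) = some (b x) := by
  have hconst : ∀ {A : Set ((ι → K) → K)} {R : (ι → K) → List K},
      (∀ a ∈ A, ∃ o : Operand K ι, ∀ x, o.eval x (R x) = some (a x)) →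
      ∀ a ∈ withConsts K A, ∃ o : Operand K ι, ∀ x, o.eval x (R x) = some (a x) := by
    rintro A R hA a (ha | ⟨c, rfl⟩)
    · exact hA a ha
    · exact ⟨.const c, fun x => rfl⟩
  induction t generalizing R L with
  | done hB =>
    exact ⟨[], Nat.zero_le _, R, fun x => rfl, fun b hb => hconst hA b (hB hb)⟩
  | @step A B N c hc _ ih =>
    obtain ⟨a, ha, b, hb, hop⟩ := hc
    obtain ⟨oa, hoa⟩ := hconst hA a ha
    obtain ⟨ob, hob⟩ := hconst hA b hb
    have : ∃ op : ArithOp, ∀ x, op.eval (a x) (b x) = some (c x) := by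
      rcases hop with rfl | rfl | rfl | ⟨hu, rfl⟩
      · exact ⟨.add, fun x => rfl⟩
      · exact ⟨.sub, fun x => rfl⟩
      · exact ⟨.mul, fun x => rfl⟩
      · refine ⟨.div, fun x => ?_⟩
        have hx : b x ≠ 0 := (Pi.isUnit_iff.1 hu x).ne_zero
        simp [ArithOp.eval, hx]
    obtain ⟨op, hop⟩ := this
    obtain ⟨P, hP, R', hR', hB⟩ := ih (fun x => R x ++ [c x]) (L + 1) (fun x => by simp [hL]) (by
      rintro d (rfl | hd)
      · exact ⟨.reg L, fun x => by simp [Operand.eval, ← hL x]⟩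
      · obtain ⟨o, ho⟩ := hA d hd
        exact ⟨o, fun x => Operand.eval_append (ho x)⟩)
    refine ⟨⟨op, oa, ob⟩ :: P, by simpa using hP, R', fun x => ?_, hB⟩
    simp [runProgram, hoa, hob, hop, hR']

/-- Computations from the coordinate functions are straight-line programs. -/
theorem SLC.slpComputable {K ι o : Type*} [Field K] {f : o → (ι → K) → K} {N : ℕ}
    (t : SLC K (Set.range fun (i : ι) (x : ι → K) => x i) N (Set.range f)) :
    SLPComputable (fun x k => f k x) N := by
  obtain ⟨P, hP, R, hR, hB⟩ := t.exists_program (fun _ => []) 0 (fun _ => rfl) (by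
    rintro _ ⟨i, rfl⟩
    exact ⟨.input i, fun x => rfl⟩)
  choose out hout using fun k => hB (f k) ⟨k, rfl⟩
  exact ⟨P, out, hP, fun x => ⟨R x, hR x, fun k => hout k x⟩⟩

end Programs

/-! ### Polynomials given by coefficient functions -/

section PolyOfFun

variable {S : Type*} [CommRing S]

/-- The polynomial of degree less than `h` with coefficients `f 0, …, f (h - 1)`. -/
noncomputable def polyOfFun (h : ℕ) (f : ℕ → S) : S[X] := ∑ i ∈ Finset.range h, monomial i (f i)

theorem coeff_polyOfFun (h : ℕ) (f : ℕ → S) (t : ℕ) :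
    (polyOfFun h f).coeff t = if t < h then f t else 0 := by
  simp [polyOfFun, coeff_monomial]

theorem degree_polyOfFun_lt (h : ℕ) (f : ℕ → S) : (polyOfFun h f).degree < h := by
  rw [degree_lt_iff_coeff_zero]
  intro m hm
  rw [coeff_polyOfFun, if_neg (not_lt.2 hm)]

theorem coeff_eq_zero_of_degree_lt_nat {P : S[X]} {d i : ℕ} (h : P.degree < d) (hi : d ≤ i) :
    P.coeff i = 0 :=
  (degree_lt_iff_coeff_zero P d).1 h i hi

theorem degree_lt_succ_iff_natDegree_le {P : S[X]} {d : ℕ} :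
    P.degree < (d + 1 : ℕ) ↔ P.natDegree ≤ d := by
  rw [degree_lt_iff_coeff_zero, natDegree_le_iff_coeff_eq_zero]
  exact Iff.rfl

theorem eq_polyOfFun {P : S[X]} {h : ℕ} (hP : P.degree < h) : P = polyOfFun h P.coeff := by
  ext t
  rw [coeff_polyOfFun]
  split_ifs with ht
  · rfl
  · exact coeff_eq_zero_of_degree_lt_nat hP (not_lt.1 ht)

theorem coeff_polyOfFun_mem {K : Type*} [Field K] [Algebra K S] {A : Set S} {h : ℕ} {f : ℕ → S}
    (hf : ∀ i < h, f i ∈ withConsts K A) (t : ℕ) :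
    (polyOfFun h f).coeff t ∈ withConsts K A := by
  rw [coeff_polyOfFun]
  split_ifs with ht
  · exact hf t ht
  · exact zero_mem_withConsts A

theorem polyOfFun_add (h k : ℕ) (f : ℕ → S) :
    polyOfFun (h + k) f = polyOfFun h f + X ^ h * polyOfFun k (fun i => f (h + i)) := by
  simp only [polyOfFun, Finset.sum_range_add, Finset.mul_sum, X_pow_mul_monomial, add_comm]

end PolyOfFun

/-- Polynomials of degree less than `d` over `S` can be multiplied in `N` operations. -/
def PolyMulCost (K S : Type*) [Field K] [CommRing S] [Algebra K S] (d N : ℕ) : Prop :=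
  ∀ (A : Set S) (P Q : S[X]), P.degree < d → Q.degree < d →
    (∀ i, P.coeff i ∈ withConsts K A) → (∀ i, Q.coeff i ∈ withConsts K A) →
    SLC K A N (Set.range (P * Q).coeff)

/-! ### From the hypotheses on `M` to costs in function algebras -/

section Transfer

theorem polyOfCoeffs_coeff_apply {K X : Type*} [Field K] {n : ℕ} {P : (X → K)[X]}
    (hP : P.degree < (n + 1 : ℕ)) (x : X) :
    polyOfCoeffs (fun i : Fin (n + 1) => P.coeff i x) =
      P.map (Pi.evalRingHom (fun _ => K) x) := by
  conv_rhs => rw [eq_polyOfFun hP, polyOfFun, Polynomial.map_sum]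
  simp only [polyOfCoeffs, map_monomial, Pi.evalRingHom_apply]
  exact Fin.sum_univ_eq_sum_range (fun i => monomial i (P.coeff i x)) (n + 1)

/-- A program over `K` runs pointwise on functions, and evaluation at `x` is a ring homomorphism,
hence commutes with the product. Coefficients beyond `2 n` are the constant 0. -/
theorem IsPolyMulTime.polyMulCost {K X : Type*} [Field K] [Nonempty X] {M : ℕ → ℕ}
    (h : IsPolyMulTime K M) (n : ℕ) : PolyMulCost K (X → K) (n + 1) (M n) := by
  intro A P Q hP hQ hPA hQA
  have key := (h n).slc (A := A)
    (g := Sum.elim (fun i => P.coeff i) (fun i => Q.coeff i)) (by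
      rintro (i | i)
      · exact hPA i
      · exact hQA i)
  refine key.mono_right ?_
  rintro _ ⟨t, rfl⟩
  by_cases ht : t < 2 * n + 1
  · refine subset_withConsts _ ⟨⟨t, ht⟩, ?_⟩
    funext x
    simp only [polyMulMap, Sum.elim_inl, Sum.elim_inr]
    rw [polyOfCoeffs_coeff_apply hP, polyOfCoeffs_coeff_apply hQ, ← Polynomial.map_mul, coeff_map]
    rfl
  · have : (P * Q).coeff t = 0 := by
      refine coeff_eq_zero_of_natDegree_lt (lt_of_le_of_lt natDegree_mul_le ?_)
      have h1 : P.natDegree ≤ n := degree_lt_succ_iff_natDegree_le.1 hP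
      have h2 : Q.natDegree ≤ n := degree_lt_succ_iff_natDegree_le.1 hQ
      omega
    rw [this]
    exact zero_mem_withConsts _

theorem polyOfCoeffs_coeff {K : Type*} [Field K] {n : ℕ} (a : Fin (n + 1) → K) (i : ℕ) :
    (polyOfCoeffs a).coeff i = if h : i < n + 1 then a ⟨i, h⟩ else 0 := by
  simp only [polyOfCoeffs, finsetSum_coeff, coeff_monomial]
  split_ifs with h
  · rw [Finset.sum_eq_single ⟨i, h⟩] <;> simp +contextual [Fin.ext_iff]
  · exact Finset.sum_eq_zero fun j _ => if_neg fun (e : (j : ℕ) = i) => h (e ▸ j.2)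

theorem polyMulMap_zero {K : Type*} [Field K] (n : ℕ) (x : Fin (n + 1) ⊕ Fin (n + 1) → K) :
    polyMulMap K n x 0 = x (Sum.inl 0) * x (Sum.inr 0) := by
  simp [polyMulMap, mul_coeff_zero, polyOfCoeffs_coeff]

/-- Without operations an output is a constant or an input, and the product of the two constant
coefficients is neither. -/
theorem one_le_of_slpComputable_polyMulMap {K : Type*} [Field K] {n N : ℕ}
    (h : SLPComputable (polyMulMap K n) N) : 1 ≤ N := by
  classical
  by_contra hN
  obtain ⟨P, out, hP, h⟩ := h
  obtain rfl : P = [] := List.eq_nil_of_length_eq_zero (by omega)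
  have h0 : ∀ x, (out 0).eval x [] = some (x (Sum.inl 0) * x (Sum.inr 0)) := by
    intro x
    obtain ⟨regs, h1, h2⟩ := h x
    simp only [runProgram, Option.some.injEq] at h1
    rw [h1, h2 0, polyMulMap_zero]
  cases ho : out 0 with
  | const c =>
    have h1 := h0 fun _ => 0
    have h2 := h0 fun _ => 1
    simp only [ho, Operand.eval, Option.some.injEq] at h1 h2
    simp [h1] at h2
  | input i =>
    have h1 := h0 (Pi.single i 1)
    simp only [ho, Operand.eval, Option.some.injEq] at h1
    rcases i with i | i <;> simp at h1
  | reg k => simpa [ho, Operand.eval] using h0 0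

theorem IsSuperlinear.mono {M : ℕ → ℕ} (h : IsSuperlinear M) {m n : ℕ} (hm : 1 ≤ m) (hmn : m ≤ n) :
    M m ≤ M n :=
  Nat.le_of_mul_le_mul_left ((h m n hm hmn).trans (Nat.mul_le_mul_right _ hmn)) (hm.trans hmn)

theorem IsSuperlinear.mul_le {M : ℕ → ℕ} (h : IsSuperlinear M) {c n : ℕ} (hc : 1 ≤ c)
    (hn : 1 ≤ n) : c * M n ≤ M (c * n) := by
  have := h n (c * n) hn (Nat.le_mul_of_pos_left n hc)
  refine Nat.le_of_mul_le_mul_left (c := n) ?_ hn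
  calc n * (c * M n) = c * n * M n := by ring
    _ ≤ _ := this

/-- Super-linearity alone allows `M = 0`; the lower bound on `M 1` excludes this. It serves to
absorb linear numbers of additions into `M`. -/
theorem IsSuperlinear.self_le {K : Type*} [Field K] {M : ℕ → ℕ} (h : IsSuperlinear M)
    (hM : IsPolyMulTime K M) {n : ℕ} (hn : 1 ≤ n) : n ≤ M n := by
  have h1 := one_le_of_slpComputable_polyMulMap (hM 1)
  have h2 := h.mul_le hn le_rfl
  rw [mul_one] at h2
  exact (Nat.le_mul_of_pos_right n h1).trans h2

end Transfer

/-! ### Taylor shifts -/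

section TaylorShift

theorem natDegree_X_add_C_le {S : Type*} [CommRing S] (r : S) : (X + C r).natDegree ≤ 1 :=
  natDegree_add_le_of_degree_le natDegree_X_le ((natDegree_C r).le.trans zero_le_one)

theorem degree_X_add_C_pow_lt {S : Type*} [CommRing S] (r : S) (h : ℕ) :
    ((X + C r) ^ h).degree < ((h + 1 : ℕ) : WithBot ℕ) := by
  rw [degree_lt_succ_iff_natDegree_le]
  exact (natDegree_pow_le_of_le h (natDegree_X_add_C_le r)).trans (mul_one h).le

/-- Powers of `X + r` have coefficients in `K`, so they are free constants in the divide and conquer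
below. -/
theorem coeff_X_add_C_pow_mem {K S : Type*} [Field K] [CommRing S] [Algebra K S] (A : Set S)
    (r : K) (h i : ℕ) : ((X + C (algebraMap K S r)) ^ h).coeff i ∈ withConsts K A := by
  have : (X + C (algebraMap K S r)) ^ h = ((X + C r) ^ h).map (algebraMap K S) := by simp
  rw [this, coeff_map]
  exact algebraMap_mem_withConsts _ _

/-- Taylor shift by divide and conquer. -/
theorem SLC.taylorShift {K S : Type*} [Field K] [CommRing S] [Algebra K S] {M : ℕ → ℕ}
    (hM : ∀ n, PolyMulCost K S (n + 1) (M n)) (hs : IsSuperlinear M)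
    (hle : ∀ n, 1 ≤ n → n ≤ M n) (r : K) (k : ℕ) {A : Set S} {P : S[X]}
    (hP : P.degree < (2 ^ k : ℕ)) (hA : ∀ i, P.coeff i ∈ withConsts K A) :
    SLC K A (k * M (2 ^ k)) (Set.range (P.comp (X + C (algebraMap K S r))).coeff) := by
  induction k generalizing P with
  | zero =>
    have hP0 : P = C (P.coeff 0) := by
      exact eq_C_of_natDegree_le_zero (degree_lt_succ_iff_natDegree_le.1 hP)
    refine .done ?_
    rintro _ ⟨i, rfl⟩
    rw [hP0, C_comp, coeff_C]
    split_ifs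
    · exact hA 0
    · exact zero_mem_withConsts A
  | succ k ih =>
    set h := 2 ^ k with hh
    set L := X + C (algebraMap K S r) with hL
    have hpos : 1 ≤ h := Nat.one_le_two_pow
    set P0 := polyOfFun h P.coeff with hP0
    set P1 := polyOfFun h (fun i => P.coeff (h + i)) with hP1
    have hsplit : P.comp L = P0.comp L + L ^ h * P1.comp L := by
      have : P = P0 + X ^ h * P1 := by
        rw [hP0, hP1, ← polyOfFun_add, ← two_mul, hh, ← pow_succ']
        exact eq_polyOfFun hP
      rw [this, add_comp, mul_comp, pow_comp, X_comp]
    have hd0 : ∀ f : ℕ → S, ((polyOfFun h f).comp L).degree < (h : ℕ) := by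
      intro f
      obtain ⟨g, hg⟩ := Nat.exists_eq_add_of_le' hpos
      rw [hg, degree_lt_succ_iff_natDegree_le]
      refine natDegree_comp_le.trans ((Nat.mul_le_mul (degree_lt_succ_iff_natDegree_le.1
        (degree_polyOfFun_lt _ _)) (natDegree_X_add_C_le _)).trans (mul_one g).le)
    have t0 := ih (P := P0) (degree_polyOfFun_lt _ _) (coeff_polyOfFun_mem fun i _ => hA _)
    have t1 := ih (P := P1) (degree_polyOfFun_lt _ _) (coeff_polyOfFun_mem fun i _ => hA _)
    have tm := hM h (Set.range (P0.comp L).coeff ∪ Set.range (P1.comp L).coeff) (L ^ h)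
      (P1.comp L) (degree_X_add_C_pow_lt _ _)
      ((hd0 _).trans (by exact_mod_cast Nat.lt_succ_self h)) (coeff_X_add_C_pow_mem _ r h)
      (fun i => subset_withConsts _ (Or.inr ⟨i, rfl⟩))
    have t2 := (t0.union t1).trans_union
      (tm.mono_left (Set.subset_union_right.trans (subset_withConsts _)))
    -- Only the lower `h` coefficients need an addition: the shifted low half has degree less than
    -- `h`.
    have ta := SLC.family (K := K)
      (A := Set.range (P0.comp L).coeff ∪ Set.range (P1.comp L).coeff ∪
        Set.range (L ^ h * P1.comp L).coeff) (Finset.range h) (N := 1)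
      (B := fun i => {(P0.comp L).coeff i + (L ^ h * P1.comp L).coeff i}) fun i _ =>
        .add (subset_withConsts _ (Or.inl (Or.inl ⟨i, rfl⟩)))
          (subset_withConsts _ (Or.inr ⟨i, rfl⟩))
    have t3 := t2.trans' (ta.union (B' := Set.range (L ^ h * P1.comp L).coeff) (N' := 0)
      (.done (Set.subset_union_right.trans (subset_withConsts _))))
    refine (t3.mono_right ?_).mono_cost ?_
    · rintro _ ⟨i, rfl⟩
      rw [hsplit, coeff_add]
      by_cases hi : i < h
      · exact subset_withConsts _ (Or.inl (Set.mem_biUnion (Finset.mem_range.2 hi) rfl))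
      · rw [coeff_eq_zero_of_degree_lt_nat (hd0 _) (not_lt.1 hi), zero_add]
        exact subset_withConsts _ (Or.inr ⟨i, rfl⟩)
    · have h1 : 2 * M h ≤ M (2 ^ (k + 1)) := by
        rw [pow_succ']
        exact hs.mul_le one_le_two hpos
      have h2 := hle h hpos
      rw [Finset.card_range]
      calc k * M h + k * M h + M h + (h * 1 + 0) ≤ (k + 1) * (2 * M h) := by linarith
        _ ≤ _ := Nat.mul_le_mul_left _ h1

end TaylorShift

/-! ### Kronecker substitution -/

section Kronecker

/-- Kronecker substitution: the bivariate polynomial `∑ u i j x ^ i y ^ j` (`i, j ≤ n`) at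
`x = z ^ e`, `y = z`. -/
noncomputable def kronecker {S : Type*} [CommRing S] (e n : ℕ) (u : ℕ → ℕ → S) : S[X] :=
  ∑ i ∈ Finset.range (n + 1), ∑ j ∈ Finset.range (n + 1), monomial (e * i + j) (u i j)

theorem coeff_kronecker {S : Type*} [CommRing S] {e n : ℕ} (he : n < e) (u : ℕ → ℕ → S) (t : ℕ) :
    (kronecker e n u).coeff t = if t / e < n + 1 then
      (if t % e < n + 1 then u (t / e) (t % e) else 0) else 0 := by
  have h : ∀ i j, j ∈ Finset.range (n + 1) → (monomial (e * i + j) (u i j)).coeff t =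
      if t / e = i then (if t % e = j then u i j else 0) else 0 := by
    intro i j hj
    have hj' : j < e := by
      have := Finset.mem_range.1 hj
      omega
    rw [coeff_monomial, ← ite_and]
    refine if_congr ?_ rfl rfl
    rw [Nat.div_mod_unique (by omega)]
    constructor
    · rintro rfl
      exact ⟨add_comm _ _, hj'⟩
    · rintro ⟨rfl, -⟩
      exact add_comm _ _
  simp only [kronecker, finsetSum_coeff]
  rw [Finset.sum_congr rfl fun i _ => Finset.sum_congr rfl (h i)]
  simp only [Finset.sum_ite_irrel, Finset.sum_ite_eq, Finset.sum_const_zero, Finset.mem_range]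

theorem coeff_kronecker_mem {K S : Type*} [Field K] [CommRing S] [Algebra K S] {A : Set S}
    {e n : ℕ} (he : n < e) {u : ℕ → ℕ → S}
    (hu : ∀ i ≤ n, ∀ j ≤ n, u i j ∈ withConsts K A) (t : ℕ) :
    (kronecker e n u).coeff t ∈ withConsts K A := by
  rw [coeff_kronecker he]
  split_ifs with h1 h2
  · exact hu _ (Nat.lt_succ_iff.1 h1) _ (Nat.lt_succ_iff.1 h2)
  all_goals exact zero_mem_withConsts A

theorem natDegree_kronecker_le {S : Type*} [CommRing S] (e n : ℕ) (u : ℕ → ℕ → S) :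
    (kronecker e n u).natDegree ≤ e * n + n := by
  refine natDegree_sum_le_of_forall_le _ _ fun i hi => natDegree_sum_le_of_forall_le _ _ fun j hj =>
    (natDegree_monomial_le _).trans ?_
  exact Nat.add_le_add (Nat.mul_le_mul_left _ (Nat.lt_succ_iff.1 (Finset.mem_range.1 hi)))
    (Nat.lt_succ_iff.1 (Finset.mem_range.1 hj))

theorem map_kronecker {S T : Type*} [CommRing S] [CommRing T] (f : S →+* T) (e n : ℕ)
    (u : ℕ → ℕ → S) : (kronecker e n u).map f = kronecker e n (fun i j => f (u i j)) := by
  simp [kronecker, Polynomial.map_sum]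

theorem sum_range_mul {B : Type*} [AddCommMonoid B] (m n : ℕ) (f : ℕ → B) :
    ∑ t ∈ Finset.range (m * n), f t =
      ∑ a ∈ Finset.range m, ∑ b ∈ Finset.range n, f (n * a + b) := by
  rw [← Fin.sum_univ_eq_sum_range, ← Equiv.sum_comp finProdFinEquiv, Fintype.sum_prod_type,
    ← Fin.sum_univ_eq_sum_range (fun a => ∑ b ∈ Finset.range n, f (n * a + b))]
  refine Finset.sum_congr rfl fun a _ => ?_
  rw [← Fin.sum_univ_eq_sum_range (fun b => f (n * a + b))]
  simp [add_comm]

/-- Reading the Kronecker image of an operator in canonical form. -/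
theorem sum_coeff_kronecker_mul {K A : Type*} [Field K] [Ring A] [Algebra K A] (X D : A) (n : ℕ)
    (u v : ℕ → ℕ → K) :
    ∑ a : Fin (2 * n + 1), ∑ b : Fin (2 * n + 1),
      (kronecker (2 * n + 1) n u * kronecker (2 * n + 1) n v).coeff ((2 * n + 1) * a + b) •
        (X ^ (a : ℕ) * D ^ (b : ℕ)) =
    ∑ i ∈ Finset.range (n + 1), ∑ j ∈ Finset.range (n + 1), ∑ k ∈ Finset.range (n + 1),
      ∑ l ∈ Finset.range (n + 1), (u i j * v k l) • (X ^ (i + k) * D ^ (j + l)) := by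
  set e := 2 * n + 1 with he
  let m : ℕ → A := fun t => X ^ (t / e) * D ^ (t % e)
  -- `Ψ` reads an exponent by its two digits in base `e` and, being linear, can be tested on
  -- products of monomials. Their second exponents add up to at most `2 n < e`, so no carry occurs.
  let Ψ : K[X] →ₗ[K] A := ∑ t ∈ Finset.range (e * e), (lcoeff K t).smulRight (m t)
  have hΨ : ∀ P : K[X], Ψ P = ∑ t ∈ Finset.range (e * e), P.coeff t • m t := fun P => by
    simp [Ψ, LinearMap.sum_apply]
  have hmono : ∀ t c, t < e * e → Ψ (monomial t c) = c • m t := by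
    intro t c ht
    rw [hΨ, Finset.sum_eq_single t]
    · rw [coeff_monomial, if_pos rfl]
    · intro s _ hs
      rw [coeff_monomial, if_neg hs.symm, zero_smul]
    · exact fun h => absurd (Finset.mem_range.2 ht) h
  have hm : ∀ a b, b < e → m (e * a + b) = X ^ a * D ^ b := by
    intro a b hb
    have h1 : (e * a + b) / e = a := by
      rw [Nat.mul_add_div (by omega), Nat.div_eq_of_lt hb, add_zero]
    have h2 : (e * a + b) % e = b := by rw [Nat.mul_add_mod, Nat.mod_eq_of_lt hb]
    simp only [m, h1, h2]
  calc _ = Ψ (kronecker e n u * kronecker e n v) := by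
        rw [hΨ, sum_range_mul, ← Fin.sum_univ_eq_sum_range (fun a => ∑ b ∈ Finset.range e,
          (kronecker e n u * kronecker e n v).coeff (e * a + b) • m (e * a + b))]
        refine Finset.sum_congr rfl fun a _ => ?_
        rw [← Fin.sum_univ_eq_sum_range (fun b =>
          (kronecker e n u * kronecker e n v).coeff (e * a + b) • m (e * a + b))]
        exact Finset.sum_congr rfl fun b _ => by rw [hm _ _ b.2]
    _ = _ := by
        rw [kronecker, kronecker, Finset.sum_mul_sum]
        simp only [Finset.sum_mul_sum, map_sum]
        refine Finset.sum_congr rfl fun i hi => ?_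
        rw [Finset.sum_comm]
        refine Finset.sum_congr rfl fun j hj => Finset.sum_congr rfl fun k hk =>
          Finset.sum_congr rfl fun l hl => ?_
        rw [Finset.mem_range] at hi hj hk hl
        have h1 : e * i + j + (e * k + l) = e * (i + k) + (j + l) := by ring
        have h2 : e * (i + k) + (j + l) < e * e := by
          calc _ < e * (i + k) + e := by omega
            _ = e * (i + k + 1) := by ring
            _ ≤ _ := Nat.mul_le_mul_left _ (by omega)
        rw [monomial_mul_monomial, h1, hmono _ _ h2, hm _ _ (by omega)]

end Kronecker

/-! ### Operator products from commutative products -/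

section Operators

/-- The coefficient functions of the input operators, extended by zero. -/
noncomputable def coeffFun {K : Type*} [Field K] (n : ℕ) {ι : Type*}
    (c : Fin (n + 1) × Fin (n + 1) → ι) (i j : ℕ) : (ι → K) → K := fun x =>
  if h : i < n + 1 ∧ j < n + 1 then x (c (⟨i, h.1⟩, ⟨j, h.2⟩)) else 0

theorem coeffFun_mem {K : Type*} [Field K] (n : ℕ) {ι : Type*}
    (c : Fin (n + 1) × Fin (n + 1) → ι) (i j : ℕ) :
    coeffFun (K := K) n c i j ∈ withConsts K (Set.range fun (s : ι) (x : ι → K) => x s) := by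
  by_cases h : i < n + 1 ∧ j < n + 1
  · refine subset_withConsts _ ⟨c (⟨i, h.1⟩, ⟨j, h.2⟩), ?_⟩
    funext x
    simp only [coeffFun, dif_pos h]
  · have : coeffFun (K := K) n c i j = 0 := funext fun x => dif_neg h
    rw [this]
    exact zero_mem_withConsts _

theorem coeffFun_eq_zero {K : Type*} [Field K] (n : ℕ) {ι : Type*}
    (c : Fin (n + 1) × Fin (n + 1) → ι) {i j : ℕ} (h : n + 1 ≤ j) (x : ι → K) :
    coeffFun n c i j x = 0 := by
  exact dif_neg fun h' => absurd h'.2 (not_lt.2 h)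

theorem ofCanonical_eq_sum {K A : Type*} [Field K] [Ring A] [Algebra K A] (X D : A) (n : ℕ)
    {ι : Type*} (c : Fin (n + 1) × Fin (n + 1) → ι) (x : ι → K) :
    ofCanonical X D (fun ij => x (c ij)) = ∑ i ∈ Finset.range (n + 1), ∑ j ∈ Finset.range (n + 1),
      coeffFun n c i j x • (X ^ i * D ^ j) := by
  rw [ofCanonical, ← Fin.sum_univ_eq_sum_range
    (fun i => ∑ j ∈ Finset.range (n + 1), coeffFun n c i j x • (X ^ i * D ^ j))]
  refine Finset.sum_congr rfl fun i _ => ?_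
  rw [← Fin.sum_univ_eq_sum_range (fun j => coeffFun n c i j x • (X ^ (i : ℕ) * D ^ j))]
  refine Finset.sum_congr rfl fun j _ => ?_
  rw [coeffFun, dif_pos ⟨i.2, j.2⟩]

/-- If the product of two operators is a sum of `p` commutative products of bidegree `(n, n)`, then
operators can be multiplied by `p` multiplications of polynomials of degree at most `4 n ^ 2`. -/
theorem OpMulIn.of_commutative_products {K A : Type*} [Field K] [Ring A] [Algebra K A] {X D : A}
    {n p N₀ N₁ : ℕ} (hn : 1 ≤ n)
    {u v : ℕ → ℕ → ℕ → ((Fin (n + 1) × Fin (n + 1)) ⊕ (Fin (n + 1) × Fin (n + 1)) → K) → K}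
    {B : Set (((Fin (n + 1) × Fin (n + 1)) ⊕ (Fin (n + 1) × Fin (n + 1)) → K) → K)}
    (hB : SLC K (Set.range fun i x => x i) N₀ B)
    (hu : ∀ s < p, ∀ i ≤ n, ∀ j ≤ n, u s i j ∈ withConsts K B)
    (hv : ∀ s < p, ∀ i ≤ n, ∀ j ≤ n, v s i j ∈ withConsts K B)
    (hM : PolyMulCost K (((Fin (n + 1) × Fin (n + 1)) ⊕ (Fin (n + 1) × Fin (n + 1)) → K) → K)
      (4 * n ^ 2 + 1) N₁)
    (hprod : ∀ x, ofCanonical X D (fun ij => x (Sum.inl ij)) *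
        ofCanonical X D (fun ij => x (Sum.inr ij)) =
      ∑ s ∈ Finset.range p, ∑ i ∈ Finset.range (n + 1), ∑ j ∈ Finset.range (n + 1),
        ∑ k ∈ Finset.range (n + 1), ∑ l ∈ Finset.range (n + 1),
          (u s i j x * v s k l x) • (X ^ (i + k) * D ^ (j + l))) :
    OpMulIn K X D n (N₀ + (p * N₁ + (2 * n + 1) ^ 2 * p)) := by
  set e := 2 * n + 1 with he
  have hne : n < e := by omega
  have hdeg : ∀ w : ℕ → ℕ → ((Fin (n + 1) × Fin (n + 1)) ⊕ (Fin (n + 1) × Fin (n + 1)) → K) → K,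
      (kronecker e n w).degree < ((4 * n ^ 2 + 1 : ℕ) : WithBot ℕ) := by
    intro w
    rw [degree_lt_succ_iff_natDegree_le]
    refine (natDegree_kronecker_le e n w).trans ?_
    rw [he]
    nlinarith
  have hmul := SLC.family (K := K) (A := B) (Finset.range p) (N := N₁)
    (B := fun s => Set.range (kronecker e n (u s) * kronecker e n (v s)).coeff) fun s hs =>
      hM B _ _ (hdeg _) (hdeg _)
        (coeff_kronecker_mem hne (hu s (Finset.mem_range.1 hs)))
        (coeff_kronecker_mem hne (hv s (Finset.mem_range.1 hs)))
  let F : Fin e × Fin e → (((Fin (n + 1) × Fin (n + 1)) ⊕ (Fin (n + 1) × Fin (n + 1)) → K) → K) :=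
    fun ab => ∑ s ∈ Finset.range p,
      (kronecker e n (u s) * kronecker e n (v s)).coeff (e * ab.1 + ab.2)
  have hsum := SLC.family (K := K)
    (A := ⋃ s ∈ Finset.range p, Set.range (kronecker e n (u s) * kronecker e n (v s)).coeff)
    (Finset.univ : Finset (Fin e × Fin e)) (N := p) (B := fun ab => {F ab}) fun ab _ => by
      have := SLC.sum (K := K)
        (A := ⋃ s ∈ Finset.range p, Set.range (kronecker e n (u s) * kronecker e n (v s)).coeff)
        (Finset.range p)
        (f := fun s => (kronecker e n (u s) * kronecker e n (v s)).coeff (e * ab.1 + ab.2))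
        fun s hs => subset_withConsts _ (Set.mem_biUnion hs ⟨_, rfl⟩)
      rwa [Finset.card_range] at this
  have hall := hB.trans' (hmul.trans' hsum)
  simp only [Finset.card_range, Finset.card_univ, Fintype.card_prod, Fintype.card_fin, ← sq] at hall
  refine ⟨fun x ab => F ab x, (hall.mono_right' ?_).slpComputable, fun x => ?_⟩
  · rintro _ ⟨ab, rfl⟩
    exact Set.mem_biUnion (Finset.mem_univ ab) rfl
  · rw [hprod x, ofCanonical]
    simp only [F, Finset.sum_apply, Finset.sum_smul]
    refine Eq.trans ?_ (Finset.sum_congr rfl fun s _ => sum_coeff_kronecker_mul X D n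
      (fun i j => u s i j x) (fun i j => v s i j x))
    refine Eq.trans (Finset.sum_congr rfl fun a _ => Finset.sum_comm) ?_
    rw [Finset.sum_comm]
    refine Finset.sum_congr rfl fun s _ => Finset.sum_congr rfl fun a _ =>
      Finset.sum_congr rfl fun b _ => ?_
    congr 1
    have h := map_kronecker (Pi.evalRingHom (fun _ => K) x) e n
    have h1 := h (u s)
    have h2 := h (v s)
    simp only [Pi.evalRingHom_apply] at h1 h2
    rw [← h1, ← h2, ← Polynomial.map_mul, coeff_map]
    rfl

end Operators

/-! ### Product formulas in characteristic `p` -/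

section Identities

theorem PartialAlg.D_mul_X (K : Type u) [Field K] :
    PartialAlg.gen K OpGen.D * PartialAlg.gen K OpGen.X =
      PartialAlg.gen K OpGen.X * PartialAlg.gen K OpGen.D + 1 := by
  have := RingQuot.mkAlgHom_rel K (PartialRel.comm (K := K))
  simp only [map_mul, map_add, map_one] at this
  exact this

theorem ThetaAlg.D_mul_X (K : Type u) [Field K] :
    ThetaAlg.gen K OpGen.D * ThetaAlg.gen K OpGen.X =
      ThetaAlg.gen K OpGen.X * (ThetaAlg.gen K OpGen.D + 1) := by
  have := RingQuot.mkAlgHom_rel K (ThetaRel.comm (K := K))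
  simp only [map_mul, map_add, map_one] at this
  exact this

variable {K A : Type*} [Field K] [Ring A] [Algebra K A] {X D : A}

theorem weyl_D_mul_X_pow (h : D * X = X * D + 1) (k : ℕ) :
    D * X ^ k = X ^ k * D + k • X ^ (k - 1) := by
  induction k with
  | zero => simp
  | succ k ih =>
    rw [pow_succ, ← mul_assoc, ih, add_mul, mul_assoc, h, mul_add, mul_one, smul_mul_assoc,
      ← mul_assoc, add_assoc, Nat.add_sub_cancel, succ_nsmul']
    congr 2
    rcases k with _ | k
    · simp
    · rw [Nat.add_sub_cancel, ← pow_succ]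

/-- The commutation rule of the Weyl algebra. -/
theorem weyl_D_pow_mul_X_pow (h : D * X = X * D + 1) (j k : ℕ) {N : ℕ} (hN : j < N) :
    D ^ j * X ^ k = ∑ s ∈ Finset.range N,
      (s.factorial * j.choose s * k.choose s) • (X ^ (k - s) * D ^ (j - s)) := by
  induction j generalizing N with
  | zero =>
    rw [Finset.sum_eq_single_of_mem 0 (Finset.mem_range.2 hN)]
    · simp
    · intro s _ hs
      rw [Nat.choose_eq_zero_of_lt (Nat.pos_of_ne_zero hs), mul_zero, zero_mul, zero_smul]
  | succ j ih =>
    obtain ⟨N, rfl⟩ : ∃ N', N = N' + 1 := ⟨N - 1, by omega⟩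
    rw [pow_succ', mul_assoc, ih (Nat.lt_of_succ_lt_succ hN |>.trans (Nat.lt_succ_self N)),
      Finset.mul_sum]
    have h1 : ∀ s ∈ Finset.range (N + 1),
        D * ((s.factorial * j.choose s * k.choose s) • (X ^ (k - s) * D ^ (j - s))) =
        (s.factorial * j.choose s * k.choose s) • (X ^ (k - s) * D ^ (j + 1 - s)) +
        ((s + 1).factorial * j.choose s * k.choose (s + 1)) •
          (X ^ (k - (s + 1)) * D ^ (j + 1 - (s + 1))) := by
      intro s _
      rw [mul_smul_comm, ← mul_assoc, weyl_D_mul_X_pow h, add_mul, smul_add]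
      congr 1
      · rcases le_or_gt s j with hs | hs
        · rw [mul_assoc (X ^ _), ← pow_succ', Nat.succ_sub hs]
        · simp [Nat.choose_eq_zero_of_lt hs]
      · rw [smul_mul_assoc, smul_smul, Nat.succ_sub_succ, Nat.sub_sub]
        congr 1
        have := Nat.choose_succ_right_eq k s
        rw [Nat.factorial_succ]
        calc s.factorial * j.choose s * k.choose s * (k - s)
            = s.factorial * j.choose s * (k.choose s * (k - s)) := by ring
          _ = _ := by rw [← this]; ring
    rw [Finset.sum_congr rfl h1, Finset.sum_add_distrib]
    refine (congrArg₂ (· + ·) (Finset.sum_range_succ' _ N) (Finset.sum_range_succ _ N)).trans ?_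
    rw [Finset.sum_range_succ' _ N]
    have h2 : j.choose N = 0 := Nat.choose_eq_zero_of_lt (Nat.lt_of_succ_lt_succ hN)
    simp only [h2, mul_zero, zero_mul, zero_smul, add_zero]
    rw [add_right_comm, ← Finset.sum_add_distrib]
    congr 1
    · refine Finset.sum_congr rfl fun s _ => ?_
      rw [← add_smul, Nat.choose_succ_succ]
      congr 1
      ring
    · simp

/-- The substitution `j ↦ j + s`. Terms with `j < s` vanish through the binomial coefficient, so
truncated subtraction is harmless; the extra terms at the top vanish through `hf`. -/
theorem sum_choose_smul {B : Type*} [AddCommGroup B] [Module K B] (n s : ℕ) {f : ℕ → K}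
    (hf : ∀ j, n + 1 ≤ j → f j = 0) (g : ℕ → B) :
    ∑ j ∈ Finset.range (n + 1), ((j.choose s : K) * f j) • g (j - s) =
      ∑ j ∈ Finset.range (n + 1), (((j + s).choose s : K) * f (j + s)) • g j := by
  have h1 : ∑ j ∈ Finset.range (n + 1), ((j.choose s : K) * f j) • g (j - s) =
      ∑ j ∈ Finset.range (s + (n + 1)), ((j.choose s : K) * f j) • g (j - s) := by
    refine Finset.sum_subset (Finset.range_mono (Nat.le_add_left _ _)) fun j _ hj => ?_
    rw [hf j (by simpa using hj), mul_zero, zero_smul]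
  rw [h1, Finset.sum_range_add, Finset.sum_eq_zero, zero_add]
  · refine Finset.sum_congr rfl fun j _ => ?_
    rw [add_comm s j, Nat.add_sub_cancel]
  · intro j hj
    rw [Nat.choose_eq_zero_of_lt (Finset.mem_range.1 hj), Nat.cast_zero, zero_mul, zero_smul]

/-- Up to the scalar `s!`, the `s`-th term is the commutative product of the `s`-th divided
derivative of the left factor in `D` and of the right factor in `X`. -/
theorem weyl_product {p : ℕ} [CharP K p] (hp : p.Prime) (h : D * X = X * D + 1) (n : ℕ)
    {a b : ℕ → ℕ → K} (ha : ∀ i j, n + 1 ≤ j → a i j = 0) (hb : ∀ k l, n + 1 ≤ k → b k l = 0) :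
    (∑ i ∈ Finset.range (n + 1), ∑ j ∈ Finset.range (n + 1), a i j • (X ^ i * D ^ j)) *
      (∑ k ∈ Finset.range (n + 1), ∑ l ∈ Finset.range (n + 1), b k l • (X ^ k * D ^ l)) =
    ∑ s ∈ Finset.range p, ∑ i ∈ Finset.range (n + 1), ∑ j ∈ Finset.range (n + 1),
      ∑ k ∈ Finset.range (n + 1), ∑ l ∈ Finset.range (n + 1),
        (((s.factorial * (j + s).choose s : K) * a i (j + s)) *
          (((k + s).choose s : K) * b (k + s) l)) • (X ^ (i + k) * D ^ (j + l)) := by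
  have hcomm : ∀ j k : ℕ, D ^ j * X ^ k = ∑ s ∈ Finset.range p,
      ((s.factorial : K) * (j.choose s : K) * (k.choose s : K)) • (X ^ (k - s) * D ^ (j - s)) := by
    intro j k
    have e1 : ∀ N : ℕ, ∑ s ∈ Finset.range N,
        (s.factorial * j.choose s * k.choose s) • (X ^ (k - s) * D ^ (j - s)) =
        ∑ s ∈ Finset.range N, ((s.factorial : K) * (j.choose s : K) * (k.choose s : K)) •
          (X ^ (k - s) * D ^ (j - s)) := by
      intro N
      refine Finset.sum_congr rfl fun s _ => ?_
      rw [← Nat.cast_smul_eq_nsmul K]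
      push_cast
      rfl
    -- The range is first made long enough for the general rule, then cut at `p`, where the
    -- factorials become divisible by `p`.
    rw [weyl_D_pow_mul_X_pow h j k (N := p + (j + 1)) (by omega), e1, Finset.sum_range_add,
      Finset.sum_eq_zero (s := Finset.range (j + 1)), add_zero]
    intro s _
    have : ((p + s).factorial : K) = 0 := by
      rw [CharP.cast_eq_zero_iff K p, hp.dvd_factorial]
      exact Nat.le_add_right _ _
    rw [this, zero_mul, zero_mul, zero_smul]
  have hterm : ∀ i j k l, a i j • (X ^ i * D ^ j) * b k l • (X ^ k * D ^ l) =
      ∑ s ∈ Finset.range p, ((j.choose s : K) * a i j) • ((k.choose s : K) * b k l) •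
        (s.factorial : K) • (X ^ (i + (k - s)) * D ^ ((j - s) + l)) := by
    intro i j k l
    rw [smul_mul_smul_comm, mul_assoc, ← mul_assoc (D ^ j), hcomm, Finset.sum_mul, Finset.mul_sum,
      Finset.smul_sum]
    refine Finset.sum_congr rfl fun s _ => ?_
    rw [smul_mul_assoc, mul_smul_comm, smul_smul, smul_smul, smul_smul, pow_add, pow_add]
    congr 1
    · ring
    · simp only [mul_assoc]
  calc _ = ∑ s ∈ Finset.range p, ∑ i ∈ Finset.range (n + 1), ∑ j ∈ Finset.range (n + 1),
      ((j.choose s : K) * a i j) • ∑ k ∈ Finset.range (n + 1), ∑ l ∈ Finset.range (n + 1),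
        ((k.choose s : K) * b k l) •
          (s.factorial : K) • (X ^ (i + (k - s)) * D ^ ((j - s) + l)) := by
        rw [Finset.sum_mul_sum]
        simp only [Finset.sum_mul_sum, hterm, Finset.smul_sum]
        refine (Finset.sum_congr rfl fun i _ => Finset.sum_comm.trans (Finset.sum_congr rfl
          fun j _ => (Finset.sum_congr rfl fun k _ => Finset.sum_comm).trans
            Finset.sum_comm)).trans ?_
        exact (Finset.sum_congr rfl fun i _ => Finset.sum_comm).trans Finset.sum_comm
    _ = _ := by
        refine Finset.sum_congr rfl fun s _ => Finset.sum_congr rfl fun i _ => ?_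
        rw [sum_choose_smul n s (ha i) (fun j => ∑ k ∈ Finset.range (n + 1),
          ∑ l ∈ Finset.range (n + 1), ((k.choose s : K) * b k l) •
          (s.factorial : K) • (X ^ (i + (k - s)) * D ^ (j + l)))]
        refine Finset.sum_congr rfl fun j _ => ?_
        rw [Finset.sum_comm, Finset.sum_congr rfl fun l _ => sum_choose_smul n s (fun k => hb k l)
          (fun k => (s.factorial : K) • (X ^ (i + k) * D ^ (j + l))), Finset.sum_comm,
          Finset.smul_sum]
        refine Finset.sum_congr rfl fun k _ => ?_
        rw [Finset.smul_sum]
        refine Finset.sum_congr rfl fun l _ => ?_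
        rw [smul_smul, smul_smul]
        congr 1
        ring

theorem theta_D_mul_X_pow (h : D * X = X * (D + 1)) (k : ℕ) :
    D * X ^ k = X ^ k * (D + algebraMap K A k) := by
  induction k with
  | zero => simp
  | succ k ih =>
    rw [pow_succ, ← mul_assoc, ih, mul_assoc, add_mul, h, mul_assoc]
    congr 1
    rw [Nat.cast_succ, map_add, map_one, Algebra.commutes, ← mul_add]
    congr 1
    abel

/-- `X ^ k` is an eigenvector for commutation with `θ`: moving it to the left translates `θ` by `k`,
hence every polynomial in `θ`. -/
theorem theta_aeval_mul_X_pow (h : D * X = X * (D + 1)) (k : ℕ) (P : K[X]) :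
    aeval D P * X ^ k = X ^ k * aeval D (P.comp (Polynomial.X + C (k : K))) := by
  induction P using Polynomial.induction_on' with
  | add P Q hP hQ => rw [map_add, add_mul, hP, hQ, add_comp, map_add, mul_add]
  | monomial j c =>
    have h1 : ∀ j : ℕ, D ^ j * X ^ k = X ^ k * (D + algebraMap K A k) ^ j := by
      intro j
      induction j with
      | zero => simp
      | succ j ih =>
        rw [pow_succ, mul_assoc, theta_D_mul_X_pow (K := K) h, ← mul_assoc, ih, mul_assoc, pow_succ]
    rw [aeval_monomial, monomial_comp, map_mul, aeval_C, map_pow, map_add, aeval_X, aeval_C,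
      mul_assoc, h1, ← mul_assoc, ← mul_assoc, Algebra.commutes]

theorem aeval_eq_sum_smul_of_degree_lt {P : K[X]} {d : ℕ} (hP : P.degree < d) (x : A) :
    aeval x P = ∑ j ∈ Finset.range d, P.coeff j • x ^ j := by
  conv_lhs => rw [eq_polyOfFun hP, polyOfFun, map_sum]
  refine Finset.sum_congr rfl fun j _ => ?_
  rw [aeval_monomial, Algebra.smul_def]

theorem degree_comp_X_add_C_lt {S : Type*} [CommRing S] {P : S[X]} {d : ℕ}
    (hP : P.degree < ((d + 1 : ℕ) : WithBot ℕ)) (r : S) :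
    (P.comp (Polynomial.X + C r)).degree < ((d + 1 : ℕ) : WithBot ℕ) := by
  rw [degree_lt_succ_iff_natDegree_le] at hP ⊢
  exact natDegree_comp_le.trans ((Nat.mul_le_mul hP (natDegree_X_add_C_le _)).trans (mul_one d).le)

theorem theta_product {p : ℕ} [CharP K p] (hp : p.Prime) (h : D * X = X * (D + 1)) (n : ℕ)
    (a b : ℕ → ℕ → K) :
    (∑ i ∈ Finset.range (n + 1), ∑ j ∈ Finset.range (n + 1), a i j • (X ^ i * D ^ j)) *
      (∑ k ∈ Finset.range (n + 1), ∑ l ∈ Finset.range (n + 1), b k l • (X ^ k * D ^ l)) =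
    ∑ s ∈ Finset.range p, ∑ i ∈ Finset.range (n + 1), ∑ j ∈ Finset.range (n + 1),
      ∑ k ∈ Finset.range (n + 1), ∑ l ∈ Finset.range (n + 1),
        (((polyOfFun (n + 1) (a i)).comp (Polynomial.X + C (s : K))).coeff j *
          (if k % p = s then b k l else 0)) • (X ^ (i + k) * D ^ (j + l)) := by
  have hleft : ∀ i k : ℕ, (∑ j ∈ Finset.range (n + 1), a i j • (X ^ i * D ^ j)) * X ^ k =
      ∑ j ∈ Finset.range (n + 1),
        ((polyOfFun (n + 1) (a i)).comp (Polynomial.X + C ((k % p : ℕ) : K))).coeff j •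
          (X ^ (i + k) * D ^ j) := by
    intro i k
    have h1 : (∑ j ∈ Finset.range (n + 1), a i j • (X ^ i * D ^ j)) =
        X ^ i * aeval D (polyOfFun (n + 1) (a i)) := by
      rw [aeval_eq_sum_smul_of_degree_lt (degree_polyOfFun_lt _ _), Finset.mul_sum]
      refine Finset.sum_congr rfl fun j hj => ?_
      rw [coeff_polyOfFun, if_pos (Finset.mem_range.1 hj), mul_smul_comm]
    have h2 : ((k % p : ℕ) : K) = (k : K) := by
      conv_rhs => rw [← Nat.mod_add_div k p]
      simp
    rw [h1, h2, mul_assoc, theta_aeval_mul_X_pow h, ← mul_assoc, ← pow_add,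
      aeval_eq_sum_smul_of_degree_lt (degree_comp_X_add_C_lt (degree_polyOfFun_lt _ _) _),
      Finset.mul_sum]
    simp only [mul_smul_comm]
  have hinner : ∀ i k, (∑ j ∈ Finset.range (n + 1), a i j • (X ^ i * D ^ j)) *
      (∑ l ∈ Finset.range (n + 1), b k l • (X ^ k * D ^ l)) =
      ∑ s ∈ Finset.range p, ∑ j ∈ Finset.range (n + 1), ∑ l ∈ Finset.range (n + 1),
        (((polyOfFun (n + 1) (a i)).comp (Polynomial.X + C (s : K))).coeff j *
          (if k % p = s then b k l else 0)) • (X ^ (i + k) * D ^ (j + l)) := by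
    intro i k
    -- Each `k` contributes to the single residue class `s = k % p`, and `k` and `k % p` agree as
    -- scalars.
    rw [Finset.sum_eq_single_of_mem (k % p) (Finset.mem_range.2 (Nat.mod_lt _ hp.pos))]
    · simp only [if_true]
      have h1 : ∑ l ∈ Finset.range (n + 1), b k l • (X ^ k * D ^ l) =
          X ^ k * ∑ l ∈ Finset.range (n + 1), b k l • D ^ l := by
        rw [Finset.mul_sum]
        simp only [mul_smul_comm]
      rw [h1, ← mul_assoc, hleft, Finset.sum_mul]
      refine Finset.sum_congr rfl fun j _ => ?_
      rw [Finset.mul_sum]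
      refine Finset.sum_congr rfl fun l _ => ?_
      rw [smul_mul_smul_comm, mul_assoc, ← pow_add]
    · intro s _ hs
      simp [Ne.symm hs]
  rw [Finset.sum_mul_sum]
  simp only [hinner]
  refine (Finset.sum_congr rfl fun i _ => Finset.sum_comm).trans (Finset.sum_comm.trans ?_)
  exact Finset.sum_congr rfl fun s _ => Finset.sum_congr rfl fun i _ => Finset.sum_comm

end Identities

/-! ### The bound in terms of `M` -/

section OperatorCost

theorem SLPComputable.mono {K ι o : Type*} [Field K] {F : (ι → K) → o → K} {N N' : ℕ}
    (h : SLPComputable F N) (hN : N ≤ N') : SLPComputable F N' := by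
  obtain ⟨P, out, hP, hF⟩ := h
  exact ⟨P, out, hP.trans hN, hF⟩

theorem OpMulIn.mono {K A : Type*} [Field K] [Ring A] [Algebra K A] {X D : A} {n N N' : ℕ}
    (h : OpMulIn K X D n N) (hN : N ≤ N') : OpMulIn K X D n N' := by
  obtain ⟨F, hF, hx⟩ := h
  exact ⟨F, hF.mono hN, hx⟩

variable {K A : Type*} [Field K] [Ring A] [Algebra K A] {X D : A} {M : ℕ → ℕ}

/-- Factorials and binomial coefficients are constants of `K`, so preparing the factors costs one
multiplication per entry, on either side. -/
theorem OpMulIn.of_weyl {p : ℕ} [CharP K p] (hp : p.Prime) (h : D * X = X * D + 1)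
    (hM : IsPolyMulTime K M) {n : ℕ} (hn : 1 ≤ n) :
    OpMulIn K X D n (p * ((n + 1) * (n + 1)) * (1 + 1) +
      (p * M (4 * n ^ 2) + (2 * n + 1) ^ 2 * p)) := by
  let S := ((Fin (n + 1) × Fin (n + 1)) ⊕ (Fin (n + 1) × Fin (n + 1)) → K) → K
  let u : ℕ → ℕ → ℕ → S := fun s i j =>
    algebraMap K S (s.factorial * (j + s).choose s) * coeffFun n Sum.inl i (j + s)
  let v : ℕ → ℕ → ℕ → S := fun s k l =>
    algebraMap K S ((k + s).choose s) * coeffFun n Sum.inr (k + s) l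
  let I := Finset.range p ×ˢ Finset.range (n + 1) ×ˢ Finset.range (n + 1)
  have hB := SLC.family (K := K) (S := S) (A := Set.range fun i x => x i) I (N := 1 + 1)
    (B := fun t => {u t.1 t.2.1 t.2.2} ∪ {v t.1 t.2.1 t.2.2}) fun t _ =>
      (SLC.mul (algebraMap_mem_withConsts _ _) (coeffFun_mem _ _ _ _)).union
        (SLC.mul (algebraMap_mem_withConsts _ _) (coeffFun_mem _ _ _ _))
  have hmem : ∀ s < p, ∀ i ≤ n, ∀ j ≤ n, (s, i, j) ∈ I := by
    intro s hs i hi j hj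
    simp only [I, Finset.mem_product, Finset.mem_range]
    omega
  simp only [I, Finset.card_product, Finset.card_range] at hB
  refine OpMulIn.of_commutative_products hn hB (u := u) (v := v)
    (fun s hs i hi j hj => subset_withConsts _ (Set.mem_biUnion (hmem s hs i hi j hj) (Or.inl rfl)))
    (fun s hs i hi j hj => subset_withConsts _ (Set.mem_biUnion (hmem s hs i hi j hj) (Or.inr rfl)))
    (hM.polyMulCost _) fun x => ?_
  rw [ofCanonical_eq_sum, ofCanonical_eq_sum,
    weyl_product hp h n (fun i j hj => coeffFun_eq_zero n Sum.inl hj x)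
      (fun k l hk => dif_neg fun h' => absurd h'.1 (not_lt.2 hk))]
  rfl

/-- Splitting the right factor by residues is free; the preparation consists of one Taylor shift for
each `s < p` and each of the `n + 1` powers of `X` on the left. -/
theorem OpMulIn.of_theta {p : ℕ} [CharP K p] (hp : p.Prime) (h : D * X = X * (D + 1))
    (hM : IsPolyMulTime K M) (hs : IsSuperlinear M) {n k : ℕ} (hn : 1 ≤ n) (hk : n + 1 ≤ 2 ^ k) :
    OpMulIn K X D n (p * (n + 1) * (k * M (2 ^ k)) +
      (p * M (4 * n ^ 2) + (2 * n + 1) ^ 2 * p)) := by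
  let S := ((Fin (n + 1) × Fin (n + 1)) ⊕ (Fin (n + 1) × Fin (n + 1)) → K) → K
  let Q : ℕ → ℕ → S[X] := fun s i =>
    (polyOfFun (n + 1) (coeffFun n Sum.inl i)).comp (Polynomial.X + C (algebraMap K S s))
  let v : ℕ → ℕ → ℕ → S := fun s k l => if k % p = s then coeffFun n Sum.inr k l else 0
  let I := Finset.range p ×ˢ Finset.range (n + 1)
  have hB := (SLC.family (K := K) (S := S) (A := Set.range fun i x => x i) I (N := k * M (2 ^ k))
    (B := fun t => Set.range (Q t.1 t.2).coeff) fun t _ =>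
      SLC.taylorShift (fun n => hM.polyMulCost n) hs (fun n hn => hs.self_le hM hn) t.1 k
        ((degree_polyOfFun_lt _ _).trans_le (by exact_mod_cast hk))
        (coeff_polyOfFun_mem fun j _ => coeffFun_mem _ _ _ _)).union
    (.done (N := 0) (subset_withConsts _))
  simp only [I, Finset.card_product, Finset.card_range, add_zero] at hB
  refine OpMulIn.of_commutative_products hn hB (u := fun s i j => (Q s i).coeff j) (v := v)
    (fun s hs i hi j hj => subset_withConsts _ (Or.inl (Set.mem_biUnion (x := (s, i))
      (Finset.mem_product.2 ⟨Finset.mem_range.2 hs, Finset.mem_range.2 (Nat.lt_succ_of_le hi)⟩)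
      ⟨j, rfl⟩)))
    (fun s hs i hi j hj => withConsts_mono Set.subset_union_right ?_)
    (hM.polyMulCost _) fun x => ?_
  · simp only [v]
    split_ifs
    · exact coeffFun_mem _ _ _ _
    · exact zero_mem_withConsts _
  · have hQ : ∀ s i j, (Q s i).coeff j x = ((polyOfFun (n + 1)
        (fun j => coeffFun n Sum.inl i j x)).comp (Polynomial.X + C (s : K))).coeff j := by
      intro s i j
      have h1 : (Q s i).map (Pi.evalRingHom (fun _ => K) x) = (polyOfFun (n + 1)
          (fun j => coeffFun n Sum.inl i j x)).comp (Polynomial.X + C (s : K)) := by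
        simp only [Q, polyOfFun, Polynomial.map_comp, Polynomial.map_sum, map_monomial,
          Polynomial.map_add, map_X, map_C, Pi.evalRingHom_apply]
        rfl
      rw [← h1, coeff_map]
      rfl
    have hv : ∀ s k l, v s k l x = if k % p = s then coeffFun n Sum.inr k l x else 0 := by
      intro s k l
      simp only [v]
      split_ifs <;> rfl
    rw [ofCanonical_eq_sum, ofCanonical_eq_sum, theta_product hp h n]
    simp only [hQ, hv]

theorem log_two_add_one_le {n : ℕ} (hn : 2 ≤ n) : ((Nat.log 2 n + 1 : ℕ) : ℝ) ≤ 4 * Real.log n := by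
  have h1 : ((2 ^ Nat.log 2 n : ℕ) : ℝ) ≤ n := by
    exact_mod_cast Nat.pow_log_le_self 2 (by omega)
  have h2 : (Nat.log 2 n : ℝ) * Real.log 2 ≤ Real.log n := by
    have := Real.log_le_log (by positivity) h1
    rwa [Nat.cast_pow, Real.log_pow, Nat.cast_ofNat] at this
  have h3 : Real.log 2 ≤ Real.log n := Real.log_le_log two_pos (by exact_mod_cast hn)
  have h4 := Real.log_two_gt_d9
  push_cast
  nlinarith

/-- Operators in characteristic `p` are multiplied by `p` commutative products and, for `θ`, by
Taylor shifts of the left factor. -/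
theorem operator_mul_cost (κ : ℕ → ℝ) : ∃ C : ℝ, 0 < C ∧
    ∀ (p : ℕ) (_ : p.Prime) (K : Type u) [Field K] [CharP K p] (M : ℕ → ℕ),
      IsPolyMulTime K M → IsSuperlinear M → HasScaling κ M →
      ∀ n : ℕ, 1 ≤ n → ∃ N : ℕ,
        (N : ℝ) ≤ C * ((p : ℝ) * M (n ^ 2) + (p : ℝ) * n * M n * Real.log n) ∧
        PartialMulIn K n N ∧ ThetaMulIn K n N := by
  -- The two algorithms' costs are added to obtain one `N`: 8 from scaling the Weyl factors, 9 twice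
  -- from the final sums, `κ 4` twice from the products, and `8 |κ 2|` from the shifts. Absolute
  -- values are used as no sign is imposed on `κ`.
  refine ⟨26 + 2 * |κ 4| + 8 * |κ 2|, by positivity, fun p hp K _ _ M hM hs hκ n hn => ?_⟩
  set k := Nat.log 2 n + 1 with hk
  have hlt : n + 1 ≤ 2 ^ k := Nat.lt_pow_succ_log_self one_lt_two n
  have hle : 2 ^ k ≤ 2 * n := by
    rw [hk, pow_succ']
    exact Nat.mul_le_mul_left _ (Nat.pow_log_le_self 2 (by omega))
  have hP := OpMulIn.of_weyl hp (PartialAlg.D_mul_X K) hM hn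
  have hT := OpMulIn.of_theta hp (ThetaAlg.D_mul_X K) hM hs hn hlt
  refine ⟨_, ?_, hP.mono (Nat.le_add_right _ _), hT.mono (Nat.le_add_left _ _)⟩
  have hn2 : 1 ≤ n ^ 2 := Nat.one_le_pow _ _ hn
  have hsq : ((n ^ 2 : ℕ) : ℝ) ≤ M (n ^ 2) := by exact_mod_cast hs.self_le hM hn2
  have h4 : (M (4 * n ^ 2) : ℝ) ≤ |κ 4| * M (n ^ 2) :=
    (hκ 4 _ (by norm_num) hn2).trans (mul_le_mul_of_nonneg_right (le_abs_self _) (by positivity))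
  have h2 : (M (2 ^ k) : ℝ) ≤ |κ 2| * M n :=
    (Nat.cast_le.2 (hs.mono Nat.one_le_two_pow hle)).trans
      ((hκ 2 n (by norm_num) hn).trans
        (mul_le_mul_of_nonneg_right (le_abs_self _) (by positivity)))
  have hn1 : (1 : ℝ) ≤ n := by exact_mod_cast hn
  have hp0 : (0 : ℝ) ≤ p := by positivity
  have hlog : 0 ≤ Real.log n := Real.log_nonneg hn1
  have hM0 : (0 : ℝ) ≤ M n := by positivity
  have hshift : ((n : ℝ) + 1) * (k * M (2 ^ k)) ≤
      2 * |κ 2| * M (n ^ 2) + 8 * |κ 2| * (n * M n * Real.log n) := by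
    -- At `n = 1` the logarithm vanishes, and the shifts are charged to `M (n ^ 2)` instead.
    rcases hn.eq_or_lt with rfl | hn'
    · have : k = 1 := by simp [hk]
      rw [this] at h2 ⊢
      simp only [Nat.cast_one, one_pow, Real.log_one, mul_zero, add_zero, one_mul] at h2 ⊢
      linarith
    · have hk4 : (k : ℝ) ≤ 4 * Real.log n := log_two_add_one_le hn'
      calc ((n : ℝ) + 1) * (k * M (2 ^ k))
          ≤ (2 * n) * ((4 * Real.log n) * (|κ 2| * M n)) := by
            gcongr
            linarith
        _ = 8 * |κ 2| * (n * M n * Real.log n) := by ring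
        _ ≤ _ := le_add_of_nonneg_left (by positivity)
  have hq : ((2 : ℝ) * n + 1) ^ 2 ≤ 9 * M (n ^ 2) := by
    push_cast at hsq
    nlinarith
  have hw : ((n : ℝ) + 1) * (n + 1) * 2 ≤ 8 * M (n ^ 2) := by
    push_cast at hsq
    nlinarith
  push_cast
  have hsum : ((n : ℝ) + 1) * (n + 1) * 2 + (M (4 * n ^ 2) + (2 * n + 1) ^ 2) +
      (((n : ℝ) + 1) * (k * M (2 ^ k)) + (M (4 * n ^ 2) + (2 * n + 1) ^ 2)) ≤
      (26 + 2 * |κ 4| + 8 * |κ 2|) * (M (n ^ 2) + n * M n * Real.log n) := by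
    have e1 : 0 ≤ |κ 4| * (n * M n * Real.log n) := by positivity
    have e2 : 0 ≤ |κ 2| * (M (n ^ 2) : ℝ) := by positivity
    have e3 : 0 ≤ n * M n * Real.log n := by positivity
    nlinarith
  calc _ = (p : ℝ) * (((n : ℝ) + 1) * (n + 1) * 2 + (M (4 * n ^ 2) + (2 * n + 1) ^ 2) +
      (((n : ℝ) + 1) * (k * M (2 ^ k)) + (M (4 * n ^ 2) + (2 * n + 1) ^ 2))) := by ring
    _ ≤ (p : ℝ) * ((26 + 2 * |κ 4| + 8 * |κ 2|) * (M (n ^ 2) + n * M n * Real.log n)) :=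
      mul_le_mul_of_nonneg_left hsum hp0
    _ = _ := by ring

end OperatorCost

/-! ### Arithmetic modulo `y ^ N - 1` -/

section CyclicAlgebra

variable {S : Type*} [CommRing S] {N : ℕ}

/-- The generator `y ^ e` of the group algebra of `ZMod N`, that is, of `S[y] / (y ^ N - 1)`. -/
noncomputable def cyclicGen (S : Type*) [CommRing S] {N : ℕ} (e : ZMod N) :
    AddMonoidAlgebra S (ZMod N) := AddMonoidAlgebra.single e 1

theorem cyclicGen_zero : cyclicGen S (0 : ZMod N) = 1 := rfl

theorem cyclicGen_add (a b : ZMod N) :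
    cyclicGen S (a + b) = cyclicGen S a * cyclicGen S b := by
  simp [cyclicGen, AddMonoidAlgebra.single_mul_single]

theorem cyclicGen_pow (a : ZMod N) (n : ℕ) :
    cyclicGen S a ^ n = cyclicGen S ((n : ZMod N) * a) := by
  simp [cyclicGen, AddMonoidAlgebra.single_pow, nsmul_eq_mul]

theorem coeff_cyclicGen_mul (e t : ZMod N) (f : AddMonoidAlgebra S (ZMod N)) :
    (cyclicGen S e * f).coeff t = f.coeff (t - e) := by
  rw [cyclicGen, AddMonoidAlgebra.coeff_single_mul_apply, one_mul, neg_add_eq_sub]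

/-- Reduction of polynomials modulo `y ^ N - 1`. -/
noncomputable def cyclicRed (S : Type*) [CommRing S] (N : ℕ) :
    S[X] →+* AddMonoidAlgebra S (ZMod N) :=
  eval₂RingHom (algebraMap S _) (cyclicGen S 1)

theorem cyclicRed_monomial (i : ℕ) (c : S) :
    cyclicRed S N (monomial i c) = AddMonoidAlgebra.single (i : ZMod N) c := by
  rw [cyclicRed, coe_eval₂RingHom, eval₂_monomial, cyclicGen_pow, mul_one, cyclicGen]
  simp [AddMonoidAlgebra.single_mul_single]

theorem sum_ite_natCast_eq [NeZero N] (g : ℕ → S) (t : ZMod N) :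
    ∑ i ∈ Finset.range N, (if (i : ZMod N) = t then g i else 0) = g t.val := by
  rw [Finset.sum_eq_single t.val]
  · simp
  · intro i hi hne
    refine if_neg fun h => hne ?_
    rw [← h, ZMod.val_cast_of_lt (Finset.mem_range.1 hi)]
  · exact fun h => absurd (Finset.mem_range.2 (ZMod.val_lt t)) h

/-- Below degree `2 N` exponents wrap around at most once, so reducing a product costs one addition
per coefficient. -/
theorem coeff_cyclicRed [NeZero N] {f : S[X]} (hf : f.degree < ((N + N : ℕ) : WithBot ℕ))
    (t : ZMod N) : (cyclicRed S N f).coeff t = f.coeff t.val + f.coeff (N + t.val) := by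
  conv_lhs => rw [eq_polyOfFun hf, polyOfFun, map_sum]
  simp only [cyclicRed_monomial, AddMonoidAlgebra.coeff_sum, Finsupp.finsetSum_apply,
    AddMonoidAlgebra.coeff_single, Finsupp.single_apply]
  rw [Finset.sum_range_add, sum_ite_natCast_eq f.coeff]
  congr 1
  rw [← sum_ite_natCast_eq (fun i => f.coeff (N + i))]
  simp

theorem coeff_cyclicRed_of_lt [NeZero N] {f : S[X]} (hf : f.degree < (N : WithBot ℕ))
    (t : ZMod N) : (cyclicRed S N f).coeff t = f.coeff t.val := by
  rw [coeff_cyclicRed (hf.trans_le (by exact_mod_cast Nat.le_add_right _ _)),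
    coeff_eq_zero_of_degree_lt_nat hf (Nat.le_add_right _ _), add_zero]

/-- The representative of degree less than `N`. -/
noncomputable def cyclicLift (u : AddMonoidAlgebra S (ZMod N)) : S[X] :=
  polyOfFun N fun i => u.coeff (i : ZMod N)

theorem degree_cyclicLift_lt (u : AddMonoidAlgebra S (ZMod N)) :
    (cyclicLift u).degree < (N : WithBot ℕ) := degree_polyOfFun_lt _ _

theorem cyclicRed_cyclicLift [NeZero N] (u : AddMonoidAlgebra S (ZMod N)) :
    cyclicRed S N (cyclicLift u) = u := by
  ext t
  rw [cyclicLift, coeff_cyclicRed_of_lt (degree_polyOfFun_lt _ _), coeff_polyOfFun,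
    if_pos (ZMod.val_lt t), ZMod.natCast_zmod_val]

theorem degree_mul_lt_add {f g : S[X]} {a b : ℕ} (ha : 1 ≤ a) (hf : f.degree < (a : WithBot ℕ))
    (hg : g.degree < (b : WithBot ℕ)) : (f * g).degree < ((a + b : ℕ) : WithBot ℕ) := by
  obtain ⟨a, rfl⟩ := Nat.exists_eq_add_of_le' ha
  rcases b with _ | b
  · have : g = 0 := by
      rw [← degree_eq_bot]
      simpa [Nat.WithBot.lt_zero_iff] using hg
    rw [this, mul_zero, degree_zero]
    exact WithBot.bot_lt_coe _
  · rw [← add_assoc, degree_lt_succ_iff_natDegree_le]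
    rw [degree_lt_succ_iff_natDegree_le] at hf hg
    exact natDegree_mul_le.trans (by omega)

/-- Multiplication modulo `y ^ N - 1`. -/
theorem SLC.cyclic_mul {K : Type*} [Field K] [Algebra K S] [NeZero N] {T : ℕ}
    (hT : PolyMulCost K S N T) {A : Set S} {u v : AddMonoidAlgebra S (ZMod N)}
    (hu : ∀ t, u.coeff t ∈ withConsts K A) (hv : ∀ t, v.coeff t ∈ withConsts K A) :
    SLC K A (T + N) (Set.range fun t => (u * v).coeff t) := by
  have h1 := hT A (cyclicLift u) (cyclicLift v) (degree_polyOfFun_lt _ _)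
    (degree_polyOfFun_lt _ _) (coeff_polyOfFun_mem fun i _ => hu _)
    (coeff_polyOfFun_mem fun i _ => hv _)
  have h2 := SLC.family (K := K) (A := Set.range (cyclicLift u * cyclicLift v).coeff)
    (Finset.univ : Finset (ZMod N)) (N := 1) (B := fun t => {(u * v).coeff t}) fun t _ => by
      have h : u * v = cyclicRed S N (cyclicLift u * cyclicLift v) := by
        rw [map_mul, cyclicRed_cyclicLift, cyclicRed_cyclicLift]
      rw [h, coeff_cyclicRed (degree_mul_lt_add NeZero.one_le (degree_cyclicLift_lt u)
        (degree_cyclicLift_lt v))]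
      exact .add (subset_withConsts _ ⟨_, rfl⟩) (subset_withConsts _ ⟨_, rfl⟩)
  rw [Finset.card_univ, ZMod.card, mul_one] at h2
  refine (h1.trans' h2).mono_right' ?_
  rintro _ ⟨t, rfl⟩
  exact Set.mem_biUnion (Finset.mem_univ t) rfl

end CyclicAlgebra

/-! ### Fourier transform with the virtual root of unity `y` -/

section FFT

variable {S : Type*} [CommRing S] {N : ℕ}

/-- The transform `i ↦ ∑ j < n, y ^ (w i j) a j` over the group algebra of `ZMod N`. -/
noncomputable def cyclicDFT (n : ℕ) (w : ZMod N) (a : ℕ → AddMonoidAlgebra S (ZMod N)) (i : ℕ) :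
    AddMonoidAlgebra S (ZMod N) :=
  ∑ j ∈ Finset.range n, cyclicGen S (w * (i : ZMod N) * (j : ZMod N)) * a j

theorem mul_natCast_mod {n : ℕ} {w : ZMod N} (hw : w * n = 0) (i : ℕ) :
    w * (i % n : ℕ) = w * i := by
  conv_rhs => rw [← Nat.mod_add_div i n]
  push_cast
  rw [mul_add, ← mul_assoc, hw, zero_mul, add_zero]

theorem cyclicDFT_mod {n : ℕ} {w : ZMod N} (hw : w * n = 0)
    (a : ℕ → AddMonoidAlgebra S (ZMod N)) (i : ℕ) :
    cyclicDFT n w a (i % n) = cyclicDFT n w a i := by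
  simp only [cyclicDFT, mul_natCast_mod hw]

/-- Decimation in time: grouping the indices by their residue modulo `l` gives the recursion of the
fast transform. -/
theorem cyclicDFT_mul (m l : ℕ) (w : ZMod N) (a : ℕ → AddMonoidAlgebra S (ZMod N)) (i : ℕ) :
    cyclicDFT (m * l) w a i = ∑ s ∈ Finset.range l,
      cyclicGen S (w * (i : ZMod N) * (s : ZMod N)) *
        cyclicDFT m (w * (l : ZMod N)) (fun j => a (l * j + s)) i := by
  simp only [cyclicDFT]
  rw [sum_range_mul, Finset.sum_comm]
  refine Finset.sum_congr rfl fun s _ => ?_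
  rw [Finset.mul_sum]
  refine Finset.sum_congr rfl fun j _ => ?_
  rw [← mul_assoc, ← cyclicGen_add]
  congr 2
  push_cast
  ring

/-- The fast Fourier transform with radix `l`; multiplication by `y ^ e` is free. -/
theorem SLC.fft {K : Type*} [Field K] [Algebra K S] [NeZero N] {l : ℕ} (hl : 1 ≤ l) (q : ℕ)
    {w : ZMod N} (hw : w * (l ^ q : ℕ) = 0) {a : ℕ → AddMonoidAlgebra S (ZMod N)} {A : Set S}
    (ha : ∀ j < l ^ q, ∀ t, (a j).coeff t ∈ withConsts K A) :
    SLC K A (q * l ^ (q + 1) * N)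
      (Set.range fun it : ℕ × ZMod N => (cyclicDFT (l ^ q) w a it.1).coeff it.2) := by
  induction q generalizing w a with
  | zero =>
    refine .done ?_
    rintro _ ⟨⟨i, t⟩, rfl⟩
    have : cyclicDFT (l ^ 0) w a i = a 0 := by
      simp [cyclicDFT, cyclicGen_zero]
    simpa only [this] using ha 0 (by simp) t
  | succ q ih =>
    let B : ℕ → Set S := fun s => Set.range fun it : ℕ × ZMod N =>
      (cyclicDFT (l ^ q) (w * (l : ZMod N)) (fun j => a (l * j + s)) it.1).coeff it.2
    have hw' : w * l * (l ^ q : ℕ) = 0 := by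
      rw [mul_assoc, ← Nat.cast_mul, ← pow_succ', hw]
    have h1 := SLC.family (K := K) (A := A) (Finset.range l) (N := q * l ^ (q + 1) * N) (B := B)
      fun s hs => ih hw' fun j hj t => ha _ (by
        have := Finset.mem_range.1 hs
        calc l * j + s < l * (j + 1) := by rw [mul_add]; omega
          _ ≤ l * l ^ q := Nat.mul_le_mul_left _ hj
          _ = _ := (pow_succ' _ _).symm) t
    have hd : ∀ i, cyclicDFT (l ^ (q + 1)) w a i = ∑ s ∈ Finset.range l,
        cyclicGen S (w * (i : ZMod N) * (s : ZMod N)) *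
          cyclicDFT (l ^ q) (w * (l : ZMod N)) (fun j => a (l * j + s)) i := by
      intro i
      rw [pow_succ, cyclicDFT_mul]
    have h2 := SLC.family (K := K) (A := ⋃ s ∈ Finset.range l, B s)
      (Finset.range (l ^ (q + 1)) ×ˢ (Finset.univ : Finset (ZMod N))) (N := l)
      (B := fun it => {(cyclicDFT (l ^ (q + 1)) w a it.1).coeff it.2}) fun it _ => by
        simp only [hd, AddMonoidAlgebra.coeff_sum, Finsupp.finsetSum_apply, coeff_cyclicGen_mul]
        have := SLC.sum (K := K) (A := ⋃ s ∈ Finset.range l, B s) (Finset.range l)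
          (f := fun s => (cyclicDFT (l ^ q) (w * (l : ZMod N)) (fun j => a (l * j + s)) it.1).coeff
            (it.2 - w * (it.1 : ZMod N) * (s : ZMod N)))
          fun s hs => subset_withConsts _ (Set.mem_biUnion hs
            ⟨(it.1, it.2 - w * (it.1 : ZMod N) * (s : ZMod N)), rfl⟩)
        rwa [Finset.card_range] at this
    refine ((h1.trans' h2).mono_right' ?_).mono_cost (le_of_eq ?_)
    · rintro _ ⟨⟨i, t⟩, rfl⟩
      -- By periodicity, only one period of outputs has been computed.
      refine Set.mem_biUnion (x := (i % l ^ (q + 1), t)) ?_ ?_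
      · simpa using Nat.mod_lt _ (Nat.pow_pos hl)
      · simp only [cyclicDFT_mod hw, Set.mem_singleton_iff]
    · simp only [Finset.card_product, Finset.card_range, Finset.card_univ, ZMod.card]
      ring

/-- The sum over all `N`-th roots of unity `y ^ (i d)`. -/
noncomputable def cyclicRootSum (S : Type*) [CommRing S] {N : ℕ} [NeZero N] (d : ZMod N) :
    AddMonoidAlgebra S (ZMod N) := ∑ i : ZMod N, cyclicGen S (i * d)

theorem cyclicGen_mul_cyclicRootSum [NeZero N] (d : ZMod N) (n : ℕ) :
    cyclicGen S ((n : ZMod N) * d) * cyclicRootSum S d = cyclicRootSum S d := by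
  rw [cyclicRootSum, Finset.mul_sum]
  simp only [← cyclicGen_add, ← add_mul]
  exact Equiv.sum_comp (Equiv.addLeft (n : ZMod N)) fun i => cyclicGen S (i * d)

/-- The gcd of `d` and `l ^ (q + 1)` is `l ^ i` with `i ≤ q`, since `d ≠ 0`. A Bézout coefficient
multiplied by `l ^ (q - i)` gives `n`. -/
theorem exists_natCast_mul_eq_prime_pow {l q : ℕ} (hl : l.Prime) {d : ZMod (l ^ (q + 1))}
    (hd : d ≠ 0) : ∃ n : ℕ, (n : ZMod (l ^ (q + 1))) * d = (l ^ q : ℕ) := by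
  have : NeZero (l ^ (q + 1)) := ⟨pow_ne_zero _ hl.ne_zero⟩
  obtain ⟨i, hi, hg⟩ := (Nat.dvd_prime_pow hl).1 (Nat.gcd_dvd_right d.val (l ^ (q + 1)))
  have hi' : i ≤ q := by
    by_contra h
    have : i = q + 1 := by omega
    rw [this] at hg
    have hdvd : l ^ (q + 1) ∣ d.val := by
      conv_lhs => rw [← hg]
      exact Nat.gcd_dvd_left _ _
    exact hd ((ZMod.val_eq_zero d).1 (Nat.eq_zero_of_dvd_of_lt hdvd (ZMod.val_lt d)))
  have hb := congrArg (Int.cast : ℤ → ZMod (l ^ (q + 1))) (Nat.gcd_eq_gcd_ab d.val (l ^ (q + 1)))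
  rw [hg] at hb
  push_cast at hb
  have hz : (l : ZMod (l ^ (q + 1))) ^ (q + 1) = 0 := by
    rw [← Nat.cast_pow, ZMod.natCast_self]
  rw [hz, zero_mul, add_zero, ZMod.natCast_zmod_val] at hb
  refine ⟨((Nat.gcdA d.val (l ^ (q + 1)) : ZMod (l ^ (q + 1))) * (l ^ (q - i) : ℕ)).val, ?_⟩
  rw [ZMod.natCast_zmod_val]
  calc _ = (d * (Nat.gcdA d.val (l ^ (q + 1)) : ZMod (l ^ (q + 1)))) * (l ^ (q - i) : ℕ) := by ring
    _ = _ := by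
      rw [← hb]
      push_cast
      rw [← pow_add, Nat.add_sub_cancel' hi']

/-- The root sum is invariant under all multiples of `d` in the exponent, and `l ^ q` is one of
them. This replaces orthogonality, which holds only modulo the cyclotomic polynomial. -/
theorem one_sub_mul_cyclicRootSum {l q : ℕ} (hl : l.Prime) [NeZero (l ^ (q + 1))]
    {d : ZMod (l ^ (q + 1))} (hd : d ≠ 0) :
    (1 - cyclicGen S ((l ^ q : ℕ) : ZMod (l ^ (q + 1)))) * cyclicRootSum S d = 0 := by
  obtain ⟨n, hn⟩ := exists_natCast_mul_eq_prime_pow hl hd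
  rw [sub_mul, one_mul, ← hn, cyclicGen_mul_cyclicRootSum, sub_self]

theorem cyclicRootSum_zero [NeZero N] : cyclicRootSum S (0 : ZMod N) = (N : ℕ) := by
  simp [cyclicRootSum, cyclicGen_zero, ZMod.card]

theorem sum_range_natCast_zmod [NeZero N] {B : Type*} [AddCommMonoid B] (f : ZMod N → B) :
    ∑ i ∈ Finset.range N, f (i : ZMod N) = ∑ i : ZMod N, f i := by
  refine Finset.sum_bij (fun i _ => (i : ZMod N)) (fun _ _ => Finset.mem_univ _) ?_ ?_
    fun _ _ => rfl
  · intro a ha b hb h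
    rw [← ZMod.val_cast_of_lt (Finset.mem_range.1 ha), h,
      ZMod.val_cast_of_lt (Finset.mem_range.1 hb)]
  · exact fun b _ => ⟨b.val, Finset.mem_range.2 (ZMod.val_lt b), ZMod.natCast_zmod_val b⟩

/-- Inverting the transform, up to multiples of the cyclotomic polynomial. -/
theorem one_sub_mul_cyclicDFT_neg {l q : ℕ} (hl : l.Prime) [NeZero (l ^ (q + 1))]
    (c : ℕ → AddMonoidAlgebra S (ZMod (l ^ (q + 1)))) {k : ℕ} (hk : k < l ^ (q + 1)) :
    (1 - cyclicGen S ((l ^ q : ℕ) : ZMod (l ^ (q + 1)))) *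
      cyclicDFT (l ^ (q + 1)) (-1) (cyclicDFT (l ^ (q + 1)) 1 c) k =
    (1 - cyclicGen S ((l ^ q : ℕ) : ZMod (l ^ (q + 1)))) * ((l ^ (q + 1) : ℕ) * c k) := by
  have h : cyclicDFT (l ^ (q + 1)) (-1) (cyclicDFT (l ^ (q + 1)) 1 c) k =
      ∑ j ∈ Finset.range (l ^ (q + 1)),
        cyclicRootSum S ((j : ZMod (l ^ (q + 1))) - (k : ZMod (l ^ (q + 1)))) * c j := by
    simp only [cyclicDFT, cyclicRootSum, Finset.mul_sum, Finset.sum_mul]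
    rw [Finset.sum_comm]
    refine Finset.sum_congr rfl fun j _ => ?_
    rw [← sum_range_natCast_zmod (fun i =>
      cyclicGen S (i * ((j : ZMod (l ^ (q + 1))) - (k : ZMod (l ^ (q + 1))))) * c j)]
    refine Finset.sum_congr rfl fun i _ => ?_
    rw [← mul_assoc, ← cyclicGen_add]
    congr 2
    ring
  rw [h, Finset.mul_sum, Finset.sum_eq_single k]
  · rw [sub_self, cyclicRootSum_zero]
  · intro j hj hjk
    rw [← mul_assoc, one_sub_mul_cyclicRootSum hl, zero_mul]
    rw [sub_ne_zero]
    intro h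
    refine hjk ?_
    rw [← ZMod.val_cast_of_lt (Finset.mem_range.1 hj), h, ZMod.val_cast_of_lt hk]
  · exact fun h => absurd (Finset.mem_range.2 hk) h

end FFT

/-! ### The Schönhage–Strassen step -/

section FastMultiplication

variable {K S : Type*} [Field K] [CommRing S] [Algebra K S]

theorem PolyMulCost.mono {d d' N N' : ℕ} (h : PolyMulCost K S d N) (hd : d' ≤ d) (hN : N ≤ N') :
    PolyMulCost K S d' N' := fun A P Q hP hQ hPA hQA =>
  (h A P Q (hP.trans_le (by exact_mod_cast hd)) (hQ.trans_le (by exact_mod_cast hd))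
    hPA hQA).mono_cost hN

theorem coeff_mul_eq_sum_fiber {P Q : S[X]} {d : ℕ} (hP : P.degree < (d : WithBot ℕ))
    (hQ : Q.degree < (d : WithBot ℕ)) (t : ℕ) :
    (P * Q).coeff t = ∑ ij ∈ Finset.range d ×ˢ Finset.range d with ij.1 + ij.2 = t,
      P.coeff ij.1 * Q.coeff ij.2 := by
  conv_lhs => rw [eq_polyOfFun hP, eq_polyOfFun hQ, polyOfFun, polyOfFun, Finset.sum_mul_sum,
    ← Finset.sum_product']
  simp only [finsetSum_coeff, monomial_mul_monomial, coeff_monomial, Finset.sum_filter]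

/-- Schoolbook multiplication. -/
theorem polyMulCost_schoolbook (d : ℕ) : PolyMulCost K S d (2 * d ^ 2) := by
  intro A P Q hP hQ hPA hQA
  have h1 := SLC.family (K := K) (A := A) (Finset.range d ×ˢ Finset.range d) (N := 1)
    (B := fun ij => {P.coeff ij.1 * Q.coeff ij.2}) fun ij _ => .mul (hPA _) (hQA _)
  have h2 := h1.trans' (SLC.fiber_sums (Finset.range d ×ˢ Finset.range d) (fun ij => ij.1 + ij.2)
    fun ij hij => subset_withConsts _ (Set.mem_biUnion hij rfl))
  simp only [Finset.card_product, Finset.card_range] at h2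
  refine (h2.mono_right' ?_).mono_cost (le_of_eq (by ring))
  rintro _ ⟨t, rfl⟩
  exact ⟨t, (coeff_mul_eq_sum_fiber hP hQ t).symm⟩

theorem eval₂_eq_sum_of_degree_lt {R R' : Type*} [CommRing R] [CommRing R'] (f : R →+* R') (x : R')
    {P : R[X]} {n : ℕ} (hP : P.degree < (n : WithBot ℕ)) :
    P.eval₂ f x = ∑ i ∈ Finset.range n, f (P.coeff i) * x ^ i := by
  conv_lhs => rw [eq_polyOfFun hP, polyOfFun, eval₂_finsetSum]
  simp only [eval₂_monomial]

/-- Splitting a polynomial into `J` blocks of length `h`. -/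
noncomputable def blockPoly (h J : ℕ) (P : S[X]) : S[X][X] :=
  polyOfFun J fun j => polyOfFun h fun u => P.coeff (h * j + u)

theorem eval_blockPoly {h J : ℕ} {P : S[X]} (hP : P.degree < ((J * h : ℕ) : WithBot ℕ)) :
    (blockPoly h J P).eval (X ^ h) = P := by
  conv_rhs => rw [eq_polyOfFun hP, polyOfFun, sum_range_mul]
  simp only [blockPoly, polyOfFun, eval_finsetSum, eval_monomial, Finset.sum_mul, ← pow_mul,
    monomial_mul_X_pow, add_comm]

theorem degree_coeff_blockPoly_lt (h J : ℕ) (P : S[X]) (j : ℕ) :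
    ((blockPoly h J P).coeff j).degree < (h : WithBot ℕ) := by
  rw [blockPoly, coeff_polyOfFun]
  split_ifs
  · exact degree_polyOfFun_lt _ _
  · rw [degree_zero]
    exact WithBot.bot_lt_coe _

theorem coeff_coeff_blockPoly_mem {A : Set S} (h J : ℕ) {P : S[X]}
    (hA : ∀ i, P.coeff i ∈ withConsts K A) (j i : ℕ) :
    ((blockPoly h J P).coeff j).coeff i ∈ withConsts K A := by
  rw [blockPoly, coeff_polyOfFun]
  split_ifs
  · exact coeff_polyOfFun_mem (fun _ _ => hA _) _
  · exact zero_mem_withConsts A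

theorem degree_coeff_mul_lt {h : ℕ} (hh : 1 ≤ h) {F G : S[X][X]}
    (hF : ∀ j, (F.coeff j).degree < (h : WithBot ℕ))
    (hG : ∀ j, (G.coeff j).degree < (h : WithBot ℕ)) (k : ℕ) :
    ((F * G).coeff k).degree < ((h + h : ℕ) : WithBot ℕ) := by
  rw [degree_lt_iff_coeff_zero]
  intro t ht
  rw [coeff_mul, finsetSum_coeff]
  exact Finset.sum_eq_zero fun x _ =>
    coeff_eq_zero_of_degree_lt_nat (degree_mul_lt_add hh (hF _) (hG _)) ht

/-- The transform is evaluation at `y ^ i`, hence multiplicative; this is the convolution theorem.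
-/
theorem cyclicDFT_one_eq_eval₂ {N : ℕ} {F : S[X][X]} (hF : F.degree < (N : WithBot ℕ)) (i : ℕ) :
    cyclicDFT N 1 (fun j => cyclicRed S N (F.coeff j)) i =
      F.eval₂ (cyclicRed S N) (cyclicGen S (i : ZMod N)) := by
  rw [eval₂_eq_sum_of_degree_lt _ _ hF, cyclicDFT]
  refine Finset.sum_congr rfl fun j _ => ?_
  rw [cyclicGen_pow, mul_comm, one_mul, mul_comm (i : ZMod N)]

/-- The coefficients of a polynomial of small degree, recovered from the two transforms. -/
theorem coeff_eq_of_cyclicDFT {l q : ℕ} (hl : l.Prime) (hlK : (l : K) ≠ 0) [NeZero (l ^ (q + 1))]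
    (c : ℕ → S[X]) {k : ℕ} (hk : k < l ^ (q + 1)) (hc : (c k).degree < ((l ^ q : ℕ) : WithBot ℕ))
    {t : ℕ} (ht : t < l ^ q) :
    (c k).coeff t = algebraMap K S ((l ^ (q + 1) : ℕ) : K)⁻¹ *
      ((cyclicDFT (l ^ (q + 1)) (-1) (cyclicDFT (l ^ (q + 1)) 1
        fun j => cyclicRed S (l ^ (q + 1)) (c j)) k).coeff (t : ZMod (l ^ (q + 1))) -
      (cyclicDFT (l ^ (q + 1)) (-1) (cyclicDFT (l ^ (q + 1)) 1
        fun j => cyclicRed S (l ^ (q + 1)) (c j)) k).coeff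
          ((t : ZMod (l ^ (q + 1))) - (l ^ q : ℕ))) := by
  set N := l ^ (q + 1) with hN
  have h2 : l ^ q + l ^ q ≤ N := by
    rw [hN, pow_succ', ← two_mul]
    exact Nat.mul_le_mul_right _ hl.two_le
  have hlt : (c k).degree < (N : WithBot ℕ) := hc.trans_le (by exact_mod_cast (by omega))
  have h := congrArg (fun f => f.coeff (t : ZMod N))
    (one_sub_mul_cyclicDFT_neg hl (fun j => cyclicRed S N (c j)) hk)
  have hsub : ∀ f : AddMonoidAlgebra S (ZMod N),
      ((1 - cyclicGen S ((l ^ q : ℕ) : ZMod N)) * f).coeff (t : ZMod N) =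
        f.coeff (t : ZMod N) - f.coeff ((t : ZMod N) - (l ^ q : ℕ)) := by
    intro f
    rw [sub_mul, one_mul, AddMonoidAlgebra.coeff_sub, Finsupp.sub_apply, coeff_cyclicGen_mul]
  have hval : (((t : ZMod N) - (l ^ q : ℕ)) : ZMod N).val = t + (N - l ^ q) := by
    have : ((t : ZMod N) - (l ^ q : ℕ)) = ((t + (N - l ^ q) : ℕ) : ZMod N) := by
      rw [Nat.cast_add, Nat.cast_sub (by omega), ZMod.natCast_self, zero_sub, sub_eq_add_neg]
    rw [this, ZMod.val_cast_of_lt (by omega)]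
  have hNK : ((N : ℕ) : K) ≠ 0 := by
    rw [hN, Nat.cast_pow]
    exact pow_ne_zero _ hlK
  have e1 : (cyclicRed S N (c k)).coeff (t : ZMod N) = (c k).coeff t := by
    rw [coeff_cyclicRed_of_lt hlt, ZMod.val_cast_of_lt (by omega)]
  -- Multiplying by `1 - y ^ (l ^ q)` subtracts a copy of `c k` shifted by `l ^ q`, which misses the
  -- window of exponents below `l ^ q`.
  have e2 : (cyclicRed S N (c k)).coeff ((t : ZMod N) - (l ^ q : ℕ)) = 0 := by
    rw [coeff_cyclicRed_of_lt hlt, hval, coeff_eq_zero_of_degree_lt_nat hc (by omega)]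
  simp only [hsub] at h
  rw [h, ← nsmul_eq_mul, AddMonoidAlgebra.coeff_smul, Finsupp.smul_apply, Finsupp.smul_apply,
    e1, e2, smul_zero, sub_zero, nsmul_eq_mul,
    ← mul_assoc, ← map_natCast (algebraMap K S), ← map_mul, inv_mul_cancel₀ hNK, map_one, one_mul]

/-- One level of the Schönhage–Strassen recursion with radix `l`. -/
theorem PolyMulCost.fft_step {l k T : ℕ} (hl : l.Prime) (hlK : (l : K) ≠ 0)
    (hT : PolyMulCost K S (l ^ (k + 1 + 1)) T) :
    PolyMulCost K S (l ^ (2 * k + 1))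
      (l ^ (k + 1 + 1) * T + (3 * (k + 2) * l + 4) * (l ^ (k + 1 + 1)) ^ 2) := by
  intro A P Q hP hQ hPA hQA
  have hne : NeZero (l ^ (k + 1 + 1)) := ⟨pow_ne_zero _ hl.ne_zero⟩
  have hJ : l ^ (2 * k + 1) = l ^ (k + 1) * l ^ k := by
    rw [← pow_add]
    congr 1
    ring
  rw [hJ] at hP hQ
  -- With `l ^ (k + 1)` blocks of length `l ^ k`, the product has fewer than `2 l ^ (k + 1) ≤ N`
  -- blocks, so the transform does not wrap, and each has degree less than `2 l ^ k ≤ N / l`, as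
  -- recovery requires.
  set F := blockPoly (l ^ k) (l ^ (k + 1)) P with hF
  set G := blockPoly (l ^ k) (l ^ (k + 1)) Q with hG
  set N := l ^ (k + 1 + 1) with hN
  have hpos : 1 ≤ l ^ k := Nat.pow_pos hl.pos
  have hhm : l ^ k + l ^ k ≤ l ^ (k + 1) := by
    rw [pow_succ', ← two_mul]
    exact Nat.mul_le_mul_right _ hl.two_le
  have hmN : l ^ (k + 1) + l ^ (k + 1) ≤ N := by
    rw [hN, pow_succ' l (k + 1), ← two_mul]
    exact Nat.mul_le_mul_right _ hl.two_le
  have hFN : F.degree < (N : WithBot ℕ) :=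
    (degree_polyOfFun_lt _ _).trans_le (by exact_mod_cast (by omega))
  have hGN : G.degree < (N : WithBot ℕ) :=
    (degree_polyOfFun_lt _ _).trans_le (by exact_mod_cast (by omega))
  have hHN : (F * G).degree < (N : WithBot ℕ) :=
    (degree_mul_lt_add (by omega) (degree_polyOfFun_lt _ _) (degree_polyOfFun_lt _ _)).trans_le
      (by exact_mod_cast hmN)
  have hc : ∀ j, ((F * G).coeff j).degree < ((l ^ (k + 1) : ℕ) : WithBot ℕ) := fun j =>
    (degree_coeff_mul_lt hpos (degree_coeff_blockPoly_lt _ _ _)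
      (degree_coeff_blockPoly_lt _ _ _) j).trans_le (by exact_mod_cast hhm)
  let a := cyclicDFT N 1 fun j => cyclicRed S N (F.coeff j)
  let b := cyclicDFT N 1 fun j => cyclicRed S N (G.coeff j)
  let c := cyclicDFT N 1 fun j => cyclicRed S N ((F * G).coeff j)
  let d := cyclicDFT N (-1) c
  have hab : ∀ i, a i * b i = c i := fun i => by
    simp only [a, b, c]
    rw [cyclicDFT_one_eq_eval₂ hFN, cyclicDFT_one_eq_eval₂ hGN, cyclicDFT_one_eq_eval₂ hHN,
      eval₂_mul]
  have hw : ∀ w : ZMod N, w * (l ^ (k + 1 + 1) : ℕ) = 0 := fun w => by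
    rw [← hN, ZMod.natCast_self, mul_zero]
  have hin : ∀ R : S[X], (∀ i, R.coeff i ∈ withConsts K A) → ∀ j t,
      (cyclicRed S N ((blockPoly (l ^ k) (l ^ (k + 1)) R).coeff j)).coeff t ∈ withConsts K A := by
    intro R hR j t
    rw [coeff_cyclicRed_of_lt ((degree_coeff_blockPoly_lt _ _ _ _).trans_le
      (by exact_mod_cast (by omega)))]
    exact coeff_coeff_blockPoly_mem _ _ hR _ _
  let B : (ℕ → AddMonoidAlgebra S (ZMod N)) → Set S := fun f =>
    Set.range fun it : ℕ × ZMod N => (f it.1).coeff it.2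
  have hB : ∀ f i t, (f i).coeff t ∈ withConsts K (B f) := fun f i t =>
    subset_withConsts _ ⟨(i, t), rfl⟩
  have t1 : SLC K A _ (B a ∪ B b) :=
    (SLC.fft hl.one_le (k + 1 + 1) (hw 1) fun j _ => hin P hPA j).union
      (SLC.fft hl.one_le (k + 1 + 1) (hw 1) fun j _ => hin Q hQA j)
  have t2 := t1.trans' (SLC.family (A := B a ∪ B b) (Finset.range N) (N := T + N)
    (B := fun i => Set.range fun t => (c i).coeff t) fun i _ => by
      have h := SLC.cyclic_mul (A := B a ∪ B b) (u := a i) (v := b i) hT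
        (fun t => withConsts_mono Set.subset_union_left (hB a i t))
        (fun t => withConsts_mono Set.subset_union_right (hB b i t))
      rwa [hab] at h)
  have t3 : SLC K A _ (B d) := t2.trans' (SLC.fft
    (a := c) hl.one_le (k + 1 + 1) (hw (-1)) fun j hj t =>
    subset_withConsts _ (Set.mem_biUnion (Finset.mem_range.2 hj) ⟨t, rfl⟩))
  have t4 := t3.trans' (SLC.family (A := B d)
    (Finset.range N ×ˢ Finset.range (l ^ (k + 1))) (N := 1 + 1)
    (B := fun jt => {((F * G).coeff jt.1).coeff jt.2}) fun jt hjt => by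
      rw [Finset.mem_product, Finset.mem_range, Finset.mem_range] at hjt
      rw [coeff_eq_of_cyclicDFT hl hlK (F * G).coeff hjt.1 (hc _) hjt.2]
      exact (SLC.sub (hB d _ _) (hB d _ _)).trans'
        (.mul (algebraMap_mem_withConsts _ _) (subset_withConsts _ rfl)))
  -- The blocks of the product overlap, their stride being `l ^ k`; coefficients falling on the same
  -- exponent are added.
  have t5 := t4.trans' (SLC.fiber_sums (Finset.range N ×ˢ Finset.range (l ^ (k + 1)))
    (fun jt => l ^ k * jt.1 + jt.2) fun jt hjt => subset_withConsts _ (Set.mem_biUnion hjt rfl))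
  refine (t5.mono_right' ?_).mono_cost ?_
  · rintro _ ⟨n, rfl⟩
    refine ⟨n, ?_⟩
    have hPQ : P * Q = ∑ j ∈ Finset.range N, ∑ t ∈ Finset.range (l ^ (k + 1)),
        monomial (l ^ k * j + t) (((F * G).coeff j).coeff t) := by
      rw [← eval_blockPoly hP, ← eval_blockPoly hQ, ← eval_mul, eval,
        eval₂_eq_sum_of_degree_lt _ _ hHN]
      refine Finset.sum_congr rfl fun j _ => ?_
      conv_lhs => rw [RingHom.id_apply, eq_polyOfFun (hc j), polyOfFun]
      simp only [Finset.sum_mul, ← pow_mul, monomial_mul_X_pow, add_comm]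
    rw [hPQ, ← Finset.sum_product', finsetSum_coeff]
    simp only [coeff_monomial, Finset.sum_filter]
  · simp only [Finset.card_product, Finset.card_range]
    have h1 : l ^ (k + 1 + 1 + 1) = l * N := by rw [hN, pow_succ' l (k + 1 + 1)]
    have h2 : N * l ^ (k + 1) * 3 ≤ N ^ 2 * 3 := by
      rw [sq]
      exact Nat.mul_le_mul_right _ (Nat.mul_le_mul_left _ (by omega))
    rw [h1]
    nlinarith

end FastMultiplication

/-! ### Solving the recursion; the quasi-linear bound -/

section QuasiLinear

/-- One level loses a factor up to `l ^ 4 ≤ 81`, while `r + 1` shrinks by at least `3 / 2` to `k +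
3` once `r ≥ 14`. Since `(3 / 2) ^ 13 > 2 * 81`, the exponent 13 absorbs the loss with room for the
linear term. -/
theorem fft_recursion_bound {r k l : ℕ} (hl : l ≤ 3) (hl1 : 1 ≤ l) (hr : 14 ≤ r) (hk : 2 * k ≤ r) :
    l ^ (k + 1 + 1) * (9565938 * l ^ (k + 1 + 1) * (k + 1 + 1 + 1) ^ 13) +
      (3 * (k + 2) * l + 4) * (l ^ (k + 1 + 1)) ^ 2 ≤ 9565938 * l ^ r * (r + 1) ^ 13 := by
  have h1 : (l ^ (k + 1 + 1)) ^ 2 ≤ 81 * l ^ r := by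
    calc (l ^ (k + 1 + 1)) ^ 2 = l ^ (2 * k) * l ^ 4 := by ring
      _ ≤ l ^ r * 3 ^ 4 := Nat.mul_le_mul (Nat.pow_le_pow_right hl1 hk) (Nat.pow_le_pow_left hl 4)
      _ = 81 * l ^ r := by ring
  have h2 : 1594323 * (k + 3) ^ 13 ≤ 8192 * (r + 1) ^ 13 := by
    calc 1594323 * (k + 3) ^ 13 = (3 * (k + 3)) ^ 13 := by rw [mul_pow]; norm_num
      _ ≤ (2 * (r + 1)) ^ 13 := Nat.pow_le_pow_left (by omega) 13
      _ = 8192 * (r + 1) ^ 13 := by rw [mul_pow]; norm_num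
  have h3 : r + 1 ≤ (r + 1) ^ 13 := Nat.le_self_pow (by norm_num) _
  have h4 : 81 * (9565938 * (k + 3) ^ 13 + (9 * (k + 2) + 4)) ≤ 9565938 * (r + 1) ^ 13 := by
    generalize (k + 3) ^ 13 = W at *
    generalize (r + 1) ^ 13 = Z at *
    omega
  calc _ = (l ^ (k + 1 + 1)) ^ 2 * (9565938 * (k + 3) ^ 13 + (3 * (k + 2) * l + 4)) := by ring
    _ ≤ (81 * l ^ r) * (9565938 * (k + 3) ^ 13 + (9 * (k + 2) + 4)) := by
        refine Nat.mul_le_mul h1 (Nat.add_le_add_left (Nat.add_le_add_right ?_ _) _)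
        nlinarith
    _ = l ^ r * (81 * (9565938 * (k + 3) ^ 13 + (9 * (k + 2) + 4))) := by ring
    _ ≤ l ^ r * (9565938 * (r + 1) ^ 13) := Nat.mul_le_mul_left _ h4
    _ = _ := by ring

/-- Quasi-linear multiplication of polynomials of degree less than `l ^ r`. -/
theorem polyMulCost_prime_pow {K S : Type*} [Field K] [CommRing S] [Algebra K S] {l : ℕ}
    (hl : l.Prime) (hl3 : l ≤ 3) (hlK : (l : K) ≠ 0) (r : ℕ) :
    PolyMulCost K S (l ^ r) (9565938 * l ^ r * (r + 1) ^ 13) := by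
  induction r using Nat.strong_induction_on with
  | _ r ih =>
    rcases lt_or_ge r 14 with hr | hr
    -- The constant `9565938` is `6 * 3 ^ 13`, while here `l ^ r ≤ 3 ^ 13`.
    · refine (polyMulCost_schoolbook _).mono le_rfl ?_
      have h1 : l ^ r ≤ 3 ^ 13 := (Nat.pow_le_pow_left hl3 r).trans
        (Nat.pow_le_pow_right (by norm_num) (by omega))
      have h2 : 1 ≤ (r + 1) ^ 13 := Nat.one_le_pow _ _ (by omega)
      calc 2 * (l ^ r) ^ 2 = (2 * l ^ r) * l ^ r := by ring
        _ ≤ 9565938 * l ^ r := Nat.mul_le_mul_right _ (by norm_num at h1; omega)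
        _ ≤ _ := Nat.le_mul_of_pos_right _ h2
    -- Here `k = r / 2`, so that `r ≤ 2 * k + 1`.
    · refine (PolyMulCost.fft_step hl hlK (ih (r / 2 + 1 + 1) (by omega))).mono
        (Nat.pow_le_pow_right hl.one_le (by omega))
        (fft_recursion_bound hl3 hl.one_le hr (by omega))

/-- A quasi-linear multiplication time. -/
def fastMulTime (n : ℕ) : ℕ := 28697814 * (max n 1) * (Nat.log 2 n + 2) ^ 13

theorem polyMulCost_fastMulTime {K S : Type*} [Field K] [CommRing S] [Algebra K S] {l : ℕ}
    (hl : l.Prime) (hl3 : l ≤ 3) (hlK : (l : K) ≠ 0) (n : ℕ) :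
    PolyMulCost K S (n + 1) (fastMulTime n) := by
  refine (polyMulCost_prime_pow hl hl3 hlK (Nat.log l n + 1)).mono
    (Nat.lt_pow_succ_log_self hl.one_lt n) ?_
  have h1 : l ^ (Nat.log l n + 1) ≤ 3 * max n 1 := by
    rw [pow_succ']
    refine Nat.mul_le_mul hl3 ?_
    rcases Nat.eq_zero_or_pos n with rfl | hn
    · simp
    · exact (Nat.pow_log_le_self l hn.ne').trans (le_max_left _ _)
  have h2 : Nat.log l n + 1 + 1 ≤ Nat.log 2 n + 2 :=
    Nat.add_le_add_right (Nat.log_anti_left one_lt_two hl.two_le) 2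
  calc _ ≤ 9565938 * (3 * max n 1) * (Nat.log 2 n + 2) ^ 13 :=
        Nat.mul_le_mul (Nat.mul_le_mul_left _ h1) (Nat.pow_le_pow_left h2 13)
    _ = _ := by rw [fastMulTime]; ring

theorem slpComputable_polyMulMap {K : Type*} [Field K] {n N : ℕ}
    (h : PolyMulCost K ((Fin (n + 1) ⊕ Fin (n + 1) → K) → K) (n + 1) N) :
    SLPComputable (polyMulMap K n) N := by
  let input : (Fin (n + 1) → Fin (n + 1) ⊕ Fin (n + 1)) → ℕ → (Fin (n + 1) ⊕ Fin (n + 1) → K) → K :=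
    fun c i => if hi : i < n + 1 then fun x => x (c ⟨i, hi⟩) else 0
  have hmem : ∀ c i, input c i ∈ withConsts K
      (Set.range fun (s : Fin (n + 1) ⊕ Fin (n + 1))
        (x : Fin (n + 1) ⊕ Fin (n + 1) → K) => x s) := by
    intro c i
    simp only [input]
    split_ifs with hi
    · exact subset_withConsts _ ⟨_, rfl⟩
    · exact zero_mem_withConsts _
  have hev : ∀ c x, polyOfCoeffs (fun i : Fin (n + 1) => x (c i)) =
      (polyOfFun (n + 1) (input c)).map (Pi.evalRingHom (fun _ => K) x) := by
    intro c x
    refine Eq.trans ?_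
      (polyOfCoeffs_coeff_apply (degree_polyOfFun_lt (n + 1) (input c)) x)
    refine congrArg polyOfCoeffs (funext fun i => ?_)
    simp only [coeff_polyOfFun, if_pos i.2, input, dif_pos i.2]
  have key := h _ (polyOfFun (n + 1) (input Sum.inl)) (polyOfFun (n + 1) (input Sum.inr))
    (degree_polyOfFun_lt _ _) (degree_polyOfFun_lt _ _)
    (coeff_polyOfFun_mem fun i _ => hmem _ i) (coeff_polyOfFun_mem fun i _ => hmem _ i)
  have h2 := (key.mono_right' (B' := Set.range fun k : Fin (2 * n + 1) =>
    (polyOfFun (n + 1) (input Sum.inl) * polyOfFun (n + 1) (input Sum.inr)).coeff k) (by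
      rintro _ ⟨k, rfl⟩
      exact ⟨_, rfl⟩)).slpComputable
  convert h2 using 1
  funext x k
  rw [polyMulMap, hev, hev, ← Polynomial.map_mul, coeff_map]
  rfl

/-- Radix 2 serves unless `p = 2`, where radix 3 is used; the time bound covers both, which makes it
independent of `p`. -/
theorem isPolyMulTime_fastMulTime {p : ℕ} (hp : p.Prime) (K : Type*) [Field K] [CharP K p] :
    IsPolyMulTime K fastMulTime := by
  intro n
  obtain ⟨l, hl, hl3, hlp⟩ : ∃ l : ℕ, l.Prime ∧ l ≤ 3 ∧ p ≠ l := by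
    by_cases h : p = 2
    · exact ⟨3, Nat.prime_three, le_rfl, by omega⟩
    · exact ⟨2, Nat.prime_two, by norm_num, h⟩
  refine slpComputable_polyMulMap (polyMulCost_fastMulTime hl hl3 ?_ n)
  rw [Ne, CharP.cast_eq_zero_iff K p, Nat.prime_dvd_prime_iff_eq hp hl]
  exact hlp

theorem isSuperlinear_fastMulTime : IsSuperlinear fastMulTime := by
  intro m n hm hmn
  have h1 : Nat.log 2 m ≤ Nat.log 2 n := Nat.log_mono_right hmn
  rw [fastMulTime, fastMulTime, max_eq_left hm, max_eq_left (hm.trans hmn)]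
  calc n * (28697814 * m * (Nat.log 2 m + 2) ^ 13)
      = (28697814 * m * n) * (Nat.log 2 m + 2) ^ 13 := by ring
    _ ≤ (28697814 * m * n) * (Nat.log 2 n + 2) ^ 13 :=
        Nat.mul_le_mul_left _ (Nat.pow_le_pow_left (by omega) 13)
    _ = _ := by ring

theorem log_two_mul_add_two_le (c n : ℕ) :
    Nat.log 2 (c * n) + 2 ≤ (Nat.log 2 c + 2) * (Nat.log 2 n + 2) := by
  have h : Nat.log 2 (c * n) < (Nat.log 2 c + 1) + (Nat.log 2 n + 1) := by
    refine Nat.log_lt_of_lt_pow' (by omega) ?_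
    rw [pow_add]
    exact Nat.mul_lt_mul'' (Nat.lt_pow_succ_log_self one_lt_two c)
      (Nat.lt_pow_succ_log_self one_lt_two n)
  nlinarith

theorem hasScaling_fastMulTime :
    HasScaling (fun c => (c : ℝ) * ((Nat.log 2 c : ℝ) + 2) ^ 13) fastMulTime := by
  intro c n hc hn
  have h1 : fastMulTime (c * n) ≤ c * (Nat.log 2 c + 2) ^ 13 * fastMulTime n := by
    rw [fastMulTime, fastMulTime, max_eq_left hn, max_eq_left (Nat.mul_pos hc hn)]
    calc 28697814 * (c * n) * (Nat.log 2 (c * n) + 2) ^ 13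
        ≤ 28697814 * (c * n) * ((Nat.log 2 c + 2) * (Nat.log 2 n + 2)) ^ 13 :=
          Nat.mul_le_mul_left _ (Nat.pow_le_pow_left (log_two_mul_add_two_le c n) 13)
      _ = _ := by ring
  beta_reduce
  exact_mod_cast h1

/-- The separate bound `x ≥ 2` keeps the logarithm away from 0 even for `j = 1`; it is applied with
`x = p n ^ 2`. The 6 comes from `Real.log 2 > 1 / 2`. -/
theorem fastMulTime_le {j : ℕ} {x : ℝ} (hj : 1 ≤ j) (hx : (j : ℝ) ≤ x) (h2 : 2 ≤ x) :
    (fastMulTime j : ℝ) ≤ 28697814 * 6 ^ 13 * (j * Real.log x ^ 13) := by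
  have hlog2 := Real.log_two_gt_d9
  have hL : Real.log 2 ≤ Real.log x := Real.log_le_log two_pos h2
  have h1 : (Nat.log 2 j : ℝ) * Real.log 2 ≤ Real.log x := by
    have h3 : ((2 ^ Nat.log 2 j : ℕ) : ℝ) ≤ x :=
      (Nat.cast_le.2 (Nat.pow_log_le_self 2 (by omega))).trans hx
    have := Real.log_le_log (by positivity) h3
    rwa [Nat.cast_pow, Real.log_pow, Nat.cast_ofNat] at this
  have h6 : (Nat.log 2 j : ℝ) + 2 ≤ 6 * Real.log x := by
    have : (0 : ℝ) ≤ Nat.log 2 j := by positivity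
    nlinarith
  rw [fastMulTime, max_eq_left hj]
  push_cast
  calc (28697814 : ℝ) * j * ((Nat.log 2 j : ℝ) + 2) ^ 13
      ≤ 28697814 * j * (6 * Real.log x) ^ 13 := by gcongr
    _ = _ := by ring

/-- Operators are multiplied in quasi-linear time in `p n ^ 2`. -/
theorem operator_mul_cost_quasilinear : ∃ (C : ℝ) (m : ℕ), 0 < C ∧
    ∀ (p : ℕ) (_ : p.Prime) (K : Type u) [Field K] [CharP K p] (n : ℕ), 1 ≤ n →
      ∃ N : ℕ,
        (N : ℝ) ≤ C * ((p : ℝ) * (n : ℝ) ^ 2 * Real.log ((p : ℝ) * (n : ℝ) ^ 2) ^ m) ∧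
        PartialMulIn K n N ∧ ThetaMulIn K n N := by
  obtain ⟨C, hC, h⟩ := operator_mul_cost.{u} fun c => (c : ℝ) * ((Nat.log 2 c : ℝ) + 2) ^ 13
  -- Thirteen logarithms come from `fastMulTime` and one from the Taylor shifts. The factor 3 is 1
  -- for the shifts plus 2 for the products, where `1 ≤ 2 * L` supplies the missing logarithm.
  refine ⟨C * (28697814 * 6 ^ 13 * 3), 14, by positivity, fun p hp K _ _ n hn => ?_⟩
  obtain ⟨N, hN, hPN, hTN⟩ := h p hp K fastMulTime (isPolyMulTime_fastMulTime hp K)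
    isSuperlinear_fastMulTime hasScaling_fastMulTime n hn
  refine ⟨N, hN.trans ?_, hPN, hTN⟩
  have hp2 : (2 : ℝ) ≤ p := by exact_mod_cast hp.two_le
  have hn1 : (1 : ℝ) ≤ n := by exact_mod_cast hn
  have hnsq : (n : ℝ) ≤ (n : ℝ) ^ 2 := le_self_pow₀ hn1 two_ne_zero
  have hx : (n : ℝ) ^ 2 ≤ p * (n : ℝ) ^ 2 := le_mul_of_one_le_left (by positivity) (by linarith)
  have hx2 : 2 ≤ (p : ℝ) * (n : ℝ) ^ 2 := by nlinarith
  have hlogn : Real.log n ≤ Real.log (p * (n : ℝ) ^ 2) :=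
    Real.log_le_log (by linarith) (hnsq.trans hx)
  have hlogn0 : 0 ≤ Real.log n := Real.log_nonneg hn1
  have hlog2 := Real.log_two_gt_d9
  have hL : Real.log 2 ≤ Real.log (p * (n : ℝ) ^ 2) := Real.log_le_log two_pos hx2
  have h1 := fastMulTime_le (j := n ^ 2) (Nat.one_le_pow _ _ hn) (by exact_mod_cast hx) hx2
  have h2 := fastMulTime_le hn (hnsq.trans hx) hx2
  set L := Real.log (p * (n : ℝ) ^ 2) with hLdef
  have hL0 : 0 ≤ L := by linarith
  push_cast at h1
  rw [mul_assoc C]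
  refine mul_le_mul_of_nonneg_left ?_ hC.le
  have e1 : (fastMulTime (n ^ 2) : ℝ) ≤ 28697814 * 6 ^ 13 * 2 * ((n : ℝ) ^ 2 * L ^ 14) := by
    refine h1.trans ?_
    have : L ^ 13 ≤ 2 * L ^ 14 := by
      rw [pow_succ]
      nlinarith [pow_nonneg hL0 13]
    calc (28697814 : ℝ) * 6 ^ 13 * ((n : ℝ) ^ 2 * L ^ 13)
        ≤ 28697814 * 6 ^ 13 * ((n : ℝ) ^ 2 * (2 * L ^ 14)) := by gcongr
      _ = _ := by ring
  have e2 : (n : ℝ) * fastMulTime n * Real.log n ≤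
      28697814 * 6 ^ 13 * ((n : ℝ) ^ 2 * L ^ 14) := by
    calc (n : ℝ) * fastMulTime n * Real.log n
        ≤ n * (28697814 * 6 ^ 13 * (n * L ^ 13)) * L := by gcongr
      _ = _ := by ring
  calc (p : ℝ) * fastMulTime (n ^ 2) + p * n * fastMulTime n * Real.log n
      = p * (fastMulTime (n ^ 2) + n * fastMulTime n * Real.log n) := by ring
    _ ≤ p * (28697814 * 6 ^ 13 * 2 * ((n : ℝ) ^ 2 * L ^ 14) +
        28697814 * 6 ^ 13 * ((n : ℝ) ^ 2 * L ^ 14)) :=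
      mul_le_mul_of_nonneg_left (add_le_add e1 e2) (by positivity)
    _ = _ := by ring

end QuasiLinear

theorem mainTheorem5 :
    (∀ κ : ℕ → ℝ, ∃ C : ℝ, 0 < C ∧
      ∀ (p : ℕ) (_ : p.Prime) (K : Type u) [Field K] [CharP K p] (M : ℕ → ℕ),
        IsPolyMulTime K M → IsSuperlinear M → HasScaling κ M →
        ∀ n : ℕ, 1 ≤ n → ∃ N : ℕ,
          (N : ℝ) ≤ C * ((p : ℝ) * M (n ^ 2) + (p : ℝ) * n * M n * Real.log n) ∧
          PartialMulIn K n N ∧ ThetaMulIn K n N) ∧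
    (∃ (C : ℝ) (m : ℕ), 0 < C ∧
      ∀ (p : ℕ) (_ : p.Prime) (K : Type u) [Field K] [CharP K p] (n : ℕ), 1 ≤ n →
        ∃ N : ℕ,
          (N : ℝ) ≤ C * ((p : ℝ) * (n : ℝ) ^ 2 * Real.log ((p : ℝ) * (n : ℝ) ^ 2) ^ m) ∧
          PartialMulIn K n N ∧ ThetaMulIn K n N) :=
  ⟨operator_mul_cost, operator_mul_cost_quasilinear⟩
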